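/- Let $(E,\|\cdot\|)$ be a real normed space of finite dimension $N\ge 1$ (for instance $\mathbb R^N$ with an arbitrary norm), let $\mathcal L$ be a Lebesgue measure on $E$ (a translation-invariant Haar measure; on $\mathbb R^N$, the Lebesgue measure $\mathcal L^N$), and write $dx$ for integration with respect to $\mathcal L$. **Boundary measure.** Let $S_1=\{v\in E:\|v\|=1\}$, let $B=\{v\in E:\|v\|\le 1\}$, and let $\mathcal H^{N-1}_{\|\cdot\|}$ be the Borel measure on $S_1$ given by $\mathcal H^{N-1}_{\|\cdot\|}(A)=N\,\mathcal L(\{rv: 0<r<1,\ v\in A\})$. **Mollifiers.** Let $\rho_n:E\times E\to[0,\infty)$, $n\in\mathbb N$, have the form $\rho_n(x,y)=\tilde\rho_n(\|x-y\|)$ with $\tilde\rho_n\ge 0$ non-increasing on $(0,\infty)$, and suppose that 1. $\sup_{n}\sup_{x}\|\rho_n(x,\cdot)\|_{L^1}<\infty$; 2. there is a constant $C_0$ such that for every $\delta>0$ $$\lim_{n\to\infty}\int_0^\delta r^{N-1}\tilde\rho_n(r)\,dr=C_0;$$ 3. for every $\delta>0$ and $x\in E$, $\displaystyle\lim_{n\to\infty}\int_{\{y:\|x-y\|\ge\delta\}}\rho_n(x,y)\,dy=0$.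 **Functions.** Let $p\in[1,\infty)$ and $f:E\to\mathbb R$. Assume either that $f$ is Lipschitz with compact support, or that $p>1$ and $f\in W^{1,p}(E,\|\cdot\|,\mathcal L)$. The latter means that $f\in L^p$ and that there are Lipschitz functions $f_k\to f$ in $L^p$ with $\liminf_k\int_E \mathrm{lip}(f_k)^p\,dx<\infty$, where $\mathrm{lip}(u)(x)=\limsup_{y\to x}|u(y)-u(x)|/\|y-x\|$. **Conclusion.** The following hold. * The measure $\mathcal H^{N-1}_{\|\cdot\|}$ is the Minkowski content of the boundary of the unit ball: for every closed $K\subset S_1$, $$\mathcal H^{N-1}_{\|\cdot\|}(K)=\liminf_{\varepsilon\downarrow0}\frac{\mathcal L(K^\varepsilon\setminus B)}{\varepsilon},$$ where $K^\varepsilon$ is the open $\varepsilon$-neighbourhood of $K$ for $\|\cdot\|$. * The function $f$ has a weak gradient $\nabla f\in L^p$. * The nonlocal energies of $f$ converge: $$\lim_{n\to\infty}\int_{E}\int_{E}\frac{|f(x)-f(y)|^p}{\|x-y\|^p}\,\rho_n(x,y)\,dy\,dx = C_0\int_{E}\int_{S_1}|\nabla f(x)\cdot v|^p\,d\mathcal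 H^{N-1}_{\|\cdot\|}(v)\,dx .$$ -/

import Mathlib

open MeasureTheory Filter Topology Metric Set
open scoped ENNReal NNReal

noncomputable section

/-- The nonlocal energy `∫ ∫ |f x - f y|^p / ‖x - y‖^p * ρ (x, y) dy dx`, as an element of
`[0, ∞]`. The diagonal is a null set. -/
def nonlocalEnergy {E : Type*} [NormedAddCommGroup E] [MeasurableSpace E]
    (μ : Measure E) (p : ℝ) (ρ : E → E → ℝ) (f : E → ℝ) : ℝ≥0∞ :=
  ∫⁻ x, ∫⁻ y, ENNReal.ofReal (|f x - f y| ^ p / ‖x - y‖ ^ p * ρ x y) ∂μ ∂μ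

/-- A sequence of radial mollifiers `ρ n (x, y) = ρr n ‖x - y‖` on a normed space of dimension `N`,
with limit mass `C₀ = lim ∫_0^δ r^(N-1) ρr n r dr`. The profiles may blow up at `0`, so they are only
required to be monotone on `(0, ∞)`. -/
structure IsMollifierSeq {E : Type*} [NormedAddCommGroup E] [NormedSpace ℝ E] [MeasurableSpace E]
    (μ : Measure E) (ρ : ℕ → E → E → ℝ) (ρr : ℕ → ℝ → ℝ) (C₀ : ℝ) : Prop where
  /-- uniform boundedness in `L¹` -/
  bounded : ∃ c : ℝ≥0, ∀ n x, ∫⁻ y, ENNReal.ofReal (ρ n x y) ∂μ ≤ c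
  radial : ∀ n x y, ρ n x y = ρr n ‖x - y‖
  nonneg : ∀ n r, 0 ≤ r → 0 ≤ ρr n r
  antitone : ∀ n, AntitoneOn (ρr n) (Ioi 0)
  tendsto_near : ∀ δ : ℝ, 0 < δ →
    Tendsto (fun n => ∫ r in (0 : ℝ)..δ, r ^ (Module.finrank ℝ E - 1) * ρr n r) atTop (𝓝 C₀)
  tendsto_far : ∀ δ : ℝ, 0 < δ → ∀ x : E,
    Tendsto (fun n => ∫⁻ y in (ball x δ)ᶜ, ENNReal.ofReal (ρ n x y) ∂μ) atTop (𝓝 0)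

/-- The local Lipschitz constant `lip f x = limsup_{y → x, y ≠ x} |f y - f x| / d(x, y)`
(it is `0` at isolated points). -/
def localLip {X : Type*} [PseudoMetricSpace X] (f : X → ℝ) (x : X) : ℝ≥0∞ :=
  limsup (fun y => ENNReal.ofReal (|f y - f x| / dist x y)) (𝓝[≠] x)

/-- The metric Sobolev space `W^{1,p}(X, d, μ)`, `1 < p < ∞`: the functions `f ∈ L^p` which are
`L^p`-limits of Lipschitz functions `u k` with `liminf ∫ (lip (u k))^p < ∞`. -/
def MemMetricSobolev {X : Type*} [PseudoMetricSpace X] [MeasurableSpace X]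
    (μ : Measure X) (p : ℝ) (f : X → ℝ) : Prop :=
  MemLp f (ENNReal.ofReal p) μ ∧
    ∃ u : ℕ → X → ℝ, (∀ k, ∃ K : ℝ≥0, LipschitzWith K (u k)) ∧
      Tendsto (fun k => eLpNorm (u k - f) (ENNReal.ofReal p) μ) atTop (𝓝 0) ∧
      liminf (fun k => ∫⁻ x, localLip (u k) x ^ p ∂μ) atTop < ⊤

/-- `g` is a weak gradient of `f`, the gradient at a point being a linear functional
`v ↦ ∇f(x) · v`: integration by parts holds against every compactly supported smooth function. -/
structure IsWeakGradient {E : Type*} [NormedAddCommGroup E] [NormedSpace ℝ E] [MeasurableSpace E]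
    (μ : Measure E) (f : E → ℝ) (g : E → E →L[ℝ] ℝ) : Prop where
  locallyIntegrable_fun : LocallyIntegrable f μ
  locallyIntegrable_grad : LocallyIntegrable g μ
  integral_eq : ∀ φ : E → ℝ, ContDiff ℝ (⊤ : ℕ∞) φ → HasCompactSupport φ → ∀ v : E,
    ∫ x, f x * fderiv ℝ φ x v ∂μ = -∫ x, φ x * g x v ∂μ

/-- The Minkowski content of a subset `K` of the boundary of the unit ball `B`, namely
`liminf_{ε ↓ 0} μ (K^ε \ B) / ε`, where `K^ε` is the `ε`-neighbourhood of `K`. For the whole unit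
sphere it is `liminf_{ε ↓ 0} (μ (B^ε) - μ B) / ε`. -/
def unitSphereContent {E : Type*} [NormedAddCommGroup E] [MeasurableSpace E]
    (μ : Measure E) (K : Set E) : ℝ≥0∞ :=
  liminf (fun ε : ℝ => μ (thickening ε K \ closedBall 0 1) / ENNReal.ofReal ε) (𝓝[>] 0)

end

/-! In polar coordinates around x, and after Tonelli, the energy becomes the integral over r > 0 of
r^(N-1) ρ̃ₙ(r) Ψ(r), where Ψ(r) integrates ‖(f(· + rw) - f)/r‖_p^p over the directions w of the unit
sphere. The weights r^(N-1) ρ̃ₙ(r) concentrate at 0 with mass C₀, so the limit is C₀ Ψ(0+) once Ψ is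
bounded and has a limit at 0+ (`tendsto_lintegral_mul_of_concentrating`).

Both properties follow from a strong gradient g: an L^p-limit of gradients of Lipschitz functions
v_k → f. Integrating along segments gives ‖f(· + h) - f‖_p ≤ ‖g·h‖_p, hence the bound on Ψ. For
Lipschitz functions, Rademacher and Fatou give the reverse inequality as r → 0; it passes to f
because replacing f by v_k changes the quotients by at most ‖w‖ ‖∇v_k - g‖_p, uniformly in r
(`IsStrongGradient.tendsto_eLpNorm`). Dominated convergence on the sphere then identifies Ψ(0+).

A compactly supported Lipschitz function is its own approximation. For p > 1, almost minimizers of a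
gradient energy among Lipschitz functions in shrinking L^p-balls around f have Cauchy gradients, by
uniform convexity (`MemMetricSobolev.exists_isStrongGradient`). The energy is taken coordinatewise
because an arbitrary norm on the dual need not be uniformly convex. Strong gradients are weak
gradients, and weak gradients are unique, so the limit formula holds for every weak gradient.

The Minkowski content comes from squeezing K^ε \ B between two shells, measured in polar
coordinates. -/

/-! ### Polar coordinates and the Minkowski content of the unit sphere. -/

section Polar

theorem shell_subset_thickening_diff {E : Type*} [NormedAddCommGroup E] [NormedSpace ℝ E]
    {T : Set E} (ε : ℝ) :
    {y | ‖y‖ ∈ Ioo 1 (1 + ε) ∧ ‖y‖⁻¹ • y ∈ T} ⊆ thickening ε T \ closedBall 0 1 := by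
  rintro y ⟨hy, hyT⟩
  refine ⟨mem_thickening_iff.2 ⟨_, hyT, ?_⟩, by simpa using hy.1⟩
  have h0 : (0 : ℝ) < ‖y‖ := one_pos.trans hy.1
  have : y - ‖y‖⁻¹ • y = (1 - ‖y‖⁻¹) • y := by rw [sub_smul, one_smul]
  rw [dist_eq_norm, this, norm_smul, Real.norm_eq_abs,
    abs_of_nonneg (sub_nonneg.2 (inv_le_one_of_one_le₀ hy.1.le)), sub_mul, inv_mul_cancel₀ h0.ne']
  linarith [hy.2]

/-- The radius 2ε adds two errors: y is within ε of a point of T, and within ‖y‖ - 1 < ε of its own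
radial projection. -/
theorem thickening_diff_subset_shell {E : Type*} [NormedAddCommGroup E] [NormedSpace ℝ E]
    {T : Set E} (hT : T ⊆ sphere 0 1) (ε : ℝ) :
    thickening ε T \ closedBall 0 1 ⊆
      {y | ‖y‖ ∈ Ioo 1 (1 + ε) ∧ ‖y‖⁻¹ • y ∈ cthickening (2 * ε) T} := by
  rintro y ⟨hy, hyB⟩
  obtain ⟨z, hz, hyz⟩ := mem_thickening_iff.1 hy
  have hy1 : 1 < ‖y‖ := by simpa using hyB
  have hz1 : ‖z‖ = 1 := by simpa using hT hz
  have hy2 : ‖y‖ < 1 + ε := by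
    have := norm_le_norm_add_norm_sub' y z
    rw [dist_eq_norm] at hyz
    linarith
  refine ⟨⟨hy1, hy2⟩, mem_cthickening_of_dist_le _ z _ _ hz ?_⟩
  have h0 : (0 : ℝ) < ‖y‖ := one_pos.trans hy1
  have : ‖y‖⁻¹ • y - y = -((1 - ‖y‖⁻¹) • y) := by rw [sub_smul, one_smul]; abel
  have h1 : dist (‖y‖⁻¹ • y) y = ‖y‖ - 1 := by
    rw [dist_eq_norm, this, norm_neg, norm_smul, Real.norm_eq_abs,
      abs_of_nonneg (sub_nonneg.2 (inv_le_one_of_one_le₀ hy1.le)), sub_mul, inv_mul_cancel₀ h0.ne',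
      one_mul]
  linarith [dist_triangle (‖y‖⁻¹ • y) y z]

variable {E : Type*} [NormedAddCommGroup E] [NormedSpace ℝ E] [FiniteDimensional ℝ E]
  [Nontrivial E] [MeasurableSpace E] [BorelSpace E] (μ : Measure E) [μ.IsAddHaarMeasure]

/-- Polar coordinates for the Lebesgue integral on a finite-dimensional normed space. -/
theorem lintegral_eq_lintegral_Ioi_lintegral_toSphere {F : E → ℝ≥0∞} (hF : Measurable F) :
    ∫⁻ y, F y ∂μ = ∫⁻ r in Ioi (0 : ℝ), ENNReal.ofReal (r ^ (Module.finrank ℝ E - 1)) *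
      ∫⁻ w : sphere (0 : E) 1, F (r • (w : E)) ∂μ.toSphere := by
  have hG : Measurable fun q : sphere (0 : E) 1 × Ioi (0 : ℝ) => F ((q.2 : ℝ) • (q.1 : E)) := by
    fun_prop
  calc ∫⁻ y, F y ∂μ = ∫⁻ y in ({0}ᶜ : Set E), F y ∂μ := by rw [restrict_compl_singleton]
    _ = ∫⁻ y : ({0}ᶜ : Set E), F y ∂(μ.comap (↑)) :=
        (lintegral_subtype_comap (measurableSet_singleton _).compl F).symm
    _ = ∫⁻ y : ({0}ᶜ : Set E), (fun q : sphere (0 : E) 1 × Ioi (0 : ℝ) =>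
          F ((q.2 : ℝ) • (q.1 : E))) (homeomorphUnitSphereProd E y) ∂(μ.comap (↑)) := by
        refine lintegral_congr fun y => ?_
        have hy : ‖(y : E)‖ ≠ 0 := norm_ne_zero_iff.2 y.2
        simp [smul_smul, hy]
    _ = ∫⁻ q, F ((q.2 : ℝ) • (q.1 : E))
          ∂(μ.toSphere.prod (Measure.volumeIoiPow (Module.finrank ℝ E - 1))) :=
        μ.measurePreserving_homeomorphUnitSphereProd.lintegral_comp hG
    _ = ∫⁻ r : Ioi (0 : ℝ), ∫⁻ w, F ((r : ℝ) • (w : E)) ∂μ.toSphere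
          ∂(Measure.volumeIoiPow (Module.finrank ℝ E - 1)) :=
        lintegral_prod_symm' _ hG
    _ = _ := by
        rw [Measure.volumeIoiPow, lintegral_withDensity_eq_lintegral_mul _ (by fun_prop)
          hG.lintegral_prod_left']
        exact lintegral_subtype_comap measurableSet_Ioi fun r : ℝ =>
          ENNReal.ofReal (r ^ (Module.finrank ℝ E - 1)) *
            ∫⁻ w : sphere (0 : E) 1, F (r • (w : E)) ∂μ.toSphere

/-- The part of the shell `1 < ‖y‖ < 1 + ε` lying over `T`. -/
theorem measure_shell {T : Set E} (hT : MeasurableSet T) (ε : ℝ) :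
    μ {y | ‖y‖ ∈ Ioo 1 (1 + ε) ∧ ‖y‖⁻¹ • y ∈ T} =
      (∫⁻ r in Ioo (1 : ℝ) (1 + ε), ENNReal.ofReal (r ^ (Module.finrank ℝ E - 1))) *
        μ.toSphere.map (↑) T := by
  have hmeas : MeasurableSet {y : E | ‖y‖ ∈ Ioo 1 (1 + ε) ∧ ‖y‖⁻¹ • y ∈ T} := by
    refine MeasurableSet.inter (measurableSet_Ioo.preimage measurable_norm) ?_
    exact hT.preimage (by fun_prop)
  rw [← lintegral_indicator_one hmeas, lintegral_eq_lintegral_Ioi_lintegral_toSphere μ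
    (measurable_one.indicator hmeas), Measure.map_apply measurable_subtype_coe hT,
    ← lintegral_mul_const _ (by fun_prop), ← lintegral_indicator measurableSet_Ioi,
    ← lintegral_indicator measurableSet_Ioo]
  refine lintegral_congr fun r => ?_
  have hS : MeasurableSet ((↑) ⁻¹' T : Set (sphere (0 : E) 1)) := hT.preimage measurable_subtype_coe
  by_cases hr : r ∈ Ioo 1 (1 + ε)
  · have h0 : 0 < r := one_pos.trans hr.1
    rw [indicator_of_mem (mem_Ioi.2 h0), indicator_of_mem hr, ← lintegral_indicator_one hS]
    congr 1
    refine lintegral_congr fun w => ?_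
    have hw : ‖r • (w : E)‖ = r := by simp [norm_smul, abs_of_pos h0]
    have hiff : r • (w : E) ∈ {y : E | ‖y‖ ∈ Ioo 1 (1 + ε) ∧ ‖y‖⁻¹ • y ∈ T} ↔
        w ∈ ((↑) ⁻¹' T : Set (sphere (0 : E) 1)) := by
      rw [mem_ofPred_eq, hw, smul_smul, inv_mul_cancel₀ h0.ne', one_smul, mem_preimage]
      exact and_iff_right hr
    by_cases hw' : w ∈ ((↑) ⁻¹' T : Set (sphere (0 : E) 1))
    · rw [indicator_of_mem hw', indicator_of_mem (hiff.2 hw')]; rfl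
    · rw [indicator_of_notMem hw', indicator_of_notMem (mt hiff.1 hw')]
  · rw [indicator_of_notMem hr]
    by_cases h0 : r ∈ Ioi (0 : ℝ)
    · rw [indicator_of_mem h0, lintegral_eq_zero_of_ae_eq_zero, mul_zero]
      refine .of_forall fun w => indicator_of_notMem (fun h => hr ?_) _
      simpa [norm_smul, abs_of_pos (mem_Ioi.1 h0)] using h.1
    · rw [indicator_of_notMem h0]

theorem ofReal_le_setLIntegral_Ioo_pow (n : ℕ) {ε : ℝ} :
    ENNReal.ofReal ε ≤ ∫⁻ r in Ioo (1 : ℝ) (1 + ε), ENNReal.ofReal (r ^ n) := by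
  calc ENNReal.ofReal ε = ∫⁻ r in Ioo (1 : ℝ) (1 + ε), 1 := by simp
    _ ≤ _ := setLIntegral_mono (by fun_prop) fun r hr =>
        ENNReal.one_le_ofReal.2 (one_le_pow₀ hr.1.le)

theorem setLIntegral_Ioo_pow_le (n : ℕ) {ε : ℝ} :
    ∫⁻ r in Ioo (1 : ℝ) (1 + ε), ENNReal.ofReal (r ^ n) ≤
      ENNReal.ofReal ((1 + ε) ^ n) * ENNReal.ofReal ε := by
  calc _ ≤ ∫⁻ r in Ioo (1 : ℝ) (1 + ε), ENNReal.ofReal ((1 + ε) ^ n) :=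
        setLIntegral_mono (by fun_prop) fun r hr => ENNReal.ofReal_le_ofReal <|
          pow_le_pow_left₀ (zero_le_one.trans hr.1.le) hr.2.le n
    _ = _ := by simp

/-- The boundary measure of the unit ball is the Minkowski content on closed sets. -/
theorem toSphere_eq_unitSphereContent {K : Set (sphere (0 : E) 1)} (hK : IsClosed K) :
    μ.toSphere K = unitSphereContent μ ((fun v : sphere (0 : E) 1 => (v : E)) '' K) := by
  have : ProperSpace E := FiniteDimensional.proper ℝ E
  set T : Set E := (fun v : sphere (0 : E) 1 => (v : E)) '' K with hTdef
  set ν : Measure E := μ.toSphere.map (↑) with hν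
  set n := Module.finrank ℝ E - 1
  have hTc : IsClosed T := (Topology.IsClosedEmbedding.subtypeVal isClosed_sphere).isClosedMap K hK
  have hTS : T ⊆ sphere 0 1 := by rintro _ ⟨v, -, rfl⟩; exact v.2
  have hνT : ν T = μ.toSphere K := by
    rw [hν, Measure.map_apply measurable_subtype_coe hTc.measurableSet, hTdef,
      preimage_image_eq _ Subtype.val_injective]
  -- The upper bound of the squeeze. Closedness of T makes the measures of its thickenings decrease
  -- to that of T.
  have hlim : Tendsto (fun ε : ℝ => ENNReal.ofReal ((1 + ε) ^ n) * ν (cthickening (2 * ε) T))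
      (𝓝[>] 0) (𝓝 (ν T)) := by
    have h1 : Tendsto (fun ε : ℝ => ENNReal.ofReal ((1 + ε) ^ n)) (𝓝[>] 0) (𝓝 1) := by
      have : Continuous fun ε : ℝ => ENNReal.ofReal ((1 + ε) ^ n) :=
        ENNReal.continuous_ofReal.comp (by fun_prop)
      simpa using (this.tendsto 0).mono_left nhdsWithin_le_nhds
    have h2 : Tendsto (fun ε : ℝ => ν (cthickening (2 * ε) T)) (𝓝[>] 0) (𝓝 (ν T)) := by
      have h := tendsto_measure_cthickening_of_isClosed (μ := ν)
        ⟨1, one_pos, measure_ne_top ν _⟩ hTc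
      have h3 : Continuous fun ε : ℝ => 2 * ε := by fun_prop
      refine (h.comp (f := fun ε : ℝ => 2 * ε) ?_).mono_left nhdsWithin_le_nhds
      simpa using h3.tendsto 0
    simpa using ENNReal.Tendsto.mul h1 (.inl one_ne_zero) h2 (.inr ENNReal.one_ne_top)
  rw [← hνT, unitSphereContent]
  refine (Tendsto.liminf_eq (tendsto_of_tendsto_of_tendsto_of_le_of_le' tendsto_const_nhds hlim
    ?_ ?_)).symm
  · filter_upwards [self_mem_nhdsWithin] with ε hε
    rw [ENNReal.le_div_iff_mul_le (.inl (ENNReal.ofReal_pos.2 hε).ne') (.inl ENNReal.ofReal_ne_top),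
      mul_comm]
    calc _ ≤ _ := mul_le_mul_left (ofReal_le_setLIntegral_Ioo_pow n) _
      _ = _ := (measure_shell μ hTc.measurableSet ε).symm
      _ ≤ _ := measure_mono (shell_subset_thickening_diff ε)
  · filter_upwards [self_mem_nhdsWithin] with ε hε
    refine ENNReal.div_le_of_le_mul ?_
    calc _ ≤ _ := measure_mono (thickening_diff_subset_shell hTS ε)
      _ = _ := measure_shell μ isClosed_cthickening.measurableSet ε
      _ ≤ _ := mul_le_mul_left (setLIntegral_Ioo_pow_le n) _
      _ = _ := by ring

end Polar

/-! ### Difference quotients in L^p and strong gradients. -/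

section DifferenceQuotient

/-- The restriction to a line is Lipschitz, hence absolutely continuous. The line derivative is used
because differentiability almost everywhere in E says nothing about one given line. -/
theorem LipschitzWith.add_sub_eq_integral_lineDeriv {E : Type*} [NormedAddCommGroup E]
    [NormedSpace ℝ E] {v : E → ℝ} {K : ℝ≥0} (hv : LipschitzWith K v) (x h : E) :
    v (x + h) - v x = ∫ t in (0 : ℝ)..1, lineDeriv ℝ v (x + t • h) h := by
  have hL : LipschitzWith (K * ‖h‖₊) fun t : ℝ => v (x + t • h) := by
    refine hv.comp (LipschitzWith.of_dist_le_mul fun s t => ?_)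
    rw [dist_add_left, dist_eq_norm, ← sub_smul, norm_smul, mul_comm, dist_eq_norm, coe_nnnorm]
  have hd : ∀ t : ℝ, lineDeriv ℝ v (x + t • h) h = deriv (fun t : ℝ => v (x + t • h)) t := by
    intro t
    have h1 : (fun s : ℝ => v (x + t • h + s • h)) =
        fun s : ℝ => (fun t : ℝ => v (x + t • h)) (t + s) := by
      funext s; simp only [add_smul, add_assoc]
    rw [lineDeriv, h1, deriv_comp_const_add (fun t : ℝ => v (x + t • h)), add_zero]
  simp_rw [hd]
  simpa using hL.lipschitzOnWith.absolutelyContinuousOnInterval.integral_deriv_eq_sub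
    (a := 0) (b := 1) |>.symm

theorem MeasureTheory.eLpNorm_ofReal_rpow {α F : Type*} [MeasurableSpace α] [NormedAddCommGroup F]
    {μ : Measure α} {p : ℝ} (hp : 1 ≤ p) (f : α → F) :
    eLpNorm f (ENNReal.ofReal p) μ ^ p = ∫⁻ x, ‖f x‖ₑ ^ p ∂μ := by
  have hp0 : 0 < p := one_pos.trans_le hp
  rw [eLpNorm_eq_lintegral_rpow_enorm_toReal (ENNReal.ofReal_pos.2 hp0).ne' ENNReal.ofReal_ne_top,
    ENNReal.toReal_ofReal hp0.le, ← ENNReal.rpow_mul, one_div_mul_cancel hp0.ne', ENNReal.rpow_one]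

theorem MeasureTheory.eLpNorm_ofReal_le_iff {α F G : Type*} [MeasurableSpace α]
    [NormedAddCommGroup F] [NormedAddCommGroup G] {μ : Measure α} {p : ℝ} (hp : 1 ≤ p)
    (f : α → F) (g : α → G) :
    eLpNorm f (ENNReal.ofReal p) μ ≤ eLpNorm g (ENNReal.ofReal p) μ ↔
      ∫⁻ x, ‖f x‖ₑ ^ p ∂μ ≤ ∫⁻ x, ‖g x‖ₑ ^ p ∂μ := by
  rw [← eLpNorm_ofReal_rpow hp, ← eLpNorm_ofReal_rpow hp,
    ENNReal.rpow_le_rpow_iff (one_pos.trans_le hp)]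

/-- Jensen's inequality, in the form of monotonicity of L^q norms on a probability space. -/
theorem enorm_intervalIntegral_zero_one_rpow_le {p : ℝ} (hp : 1 ≤ p) {F : ℝ → ℝ}
    (hF : Measurable F) :
    ‖∫ t in (0 : ℝ)..1, F t‖ₑ ^ p ≤ ∫⁻ t in Ioc (0 : ℝ) 1, ‖F t‖ₑ ^ p := by
  have : IsProbabilityMeasure (volume.restrict (Ioc (0 : ℝ) 1)) := ⟨by simp⟩
  rw [← eLpNorm_ofReal_rpow hp]
  refine ENNReal.rpow_le_rpow ?_ (zero_le_one.trans hp)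
  rw [intervalIntegral.integral_of_le zero_le_one]
  refine (enorm_integral_le_lintegral_enorm _).trans ?_
  rw [← eLpNorm_one_eq_lintegral_enorm]
  exact eLpNorm_le_eLpNorm_of_exponent_le (by simpa using hp) hF.aestronglyMeasurable

theorem aestronglyMeasurable_add_sub {E : Type*} [NormedAddCommGroup E] [SecondCountableTopology E]
    [MeasurableSpace E] [BorelSpace E] {μ : Measure E} [μ.IsAddHaarMeasure] {u : E → ℝ} (hu : AEStronglyMeasurable u μ) (h : E) :
    AEStronglyMeasurable (fun x => u (x + h) - u x) μ :=
  (hu.comp_measurePreserving (measurePreserving_add_right μ h)).sub hu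

theorem eLpNorm_add_sub_le_two_mul {E : Type*} [NormedAddCommGroup E] [SecondCountableTopology E]
    [MeasurableSpace E] [BorelSpace E] (μ : Measure E) [μ.IsAddHaarMeasure] {p : ℝ} {f : E → ℝ} (hp : 1 ≤ p) (hf : AEStronglyMeasurable f μ)
    (h : E) : eLpNorm (fun x => f (x + h) - f x) (ENNReal.ofReal p) μ ≤
      2 * eLpNorm f (ENNReal.ofReal p) μ := by
  have hmp := measurePreserving_add_right μ h
  calc _ ≤ eLpNorm (fun x => f (x + h)) (ENNReal.ofReal p) μ + eLpNorm f (ENNReal.ofReal p) μ :=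
        eLpNorm_sub_le (hf.comp_measurePreserving hmp) hf (by simpa using hp)
    _ = _ := by
        rw [two_mul]
        congr 1
        exact eLpNorm_comp_measurePreserving hf hmp

theorem eLpNorm_inv_mul_eq {α : Type*} [MeasurableSpace α] (μ : Measure α) {r : ℝ} (hr : 0 < r) (q : ℝ≥0∞) (f : α → ℝ) :
    eLpNorm (fun x => r⁻¹ * f x) q μ = ENNReal.ofReal r⁻¹ * eLpNorm f q μ := by
  have := eLpNorm_const_smul (μ := μ) r⁻¹ f q
  rw [Real.enorm_of_nonneg (inv_nonneg.2 hr.le)] at this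
  exact this

theorem aestronglyMeasurable_fderiv {E : Type*} [NormedAddCommGroup E] [NormedSpace ℝ E]
    [FiniteDimensional ℝ E] [MeasurableSpace E] [BorelSpace E] (μ : Measure E) (v : E → ℝ) : AEStronglyMeasurable (fderiv ℝ v) μ := by
  have : SecondCountableTopology (E →L[ℝ] ℝ) := by
    have : ProperSpace (E →L[ℝ] ℝ) := FiniteDimensional.proper ℝ _
    infer_instance
  borelize (E →L[ℝ] ℝ)
  exact (measurable_fderiv ℝ v).aestronglyMeasurable

theorem eLpNorm_apply_le {E : Type*} [NormedAddCommGroup E] [NormedSpace ℝ E] [MeasurableSpace E]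
    (μ : Measure E) (q : ℝ≥0∞) (g : E → E →L[ℝ] ℝ) (h : E) :
    eLpNorm (fun x => g x h) q μ ≤ ‖h‖ₑ * eLpNorm g q μ := by
  have := eLpNorm_le_nnreal_smul_eLpNorm_of_ae_le_mul (μ := μ) (f := fun x => g x h) (g := g)
    (c := ‖h‖₊) (.of_forall fun x => by
      rw [← NNReal.coe_le_coe]; simpa [mul_comm] using (g x).le_opNorm h) q
  simpa only [ENNReal.smul_def, smul_eq_mul, enorm_eq_nnnorm] using this

variable {E : Type*} [NormedAddCommGroup E] [NormedSpace ℝ E] [FiniteDimensional ℝ E]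
  [MeasurableSpace E] [BorelSpace E] (μ : Measure E) [μ.IsAddHaarMeasure] {p : ℝ}

/-- Write the increment as an average of derivatives along the segment, apply Jensen and Tonelli,
and remove each shift by translation invariance. -/
theorem LipschitzWith.eLpNorm_add_sub_le {v : E → ℝ} {K : ℝ≥0} (hv : LipschitzWith K v)
    (hp : 1 ≤ p) (h : E) :
    eLpNorm (fun x => v (x + h) - v x) (ENNReal.ofReal p) μ ≤
      eLpNorm (fun x => fderiv ℝ v x h) (ENNReal.ofReal p) μ := by
  have hae : (fun x => fderiv ℝ v x h) =ᵐ[μ] fun x => lineDeriv ℝ v x h := by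
    filter_upwards [hv.ae_differentiableAt] with x hx using hx.lineDeriv_eq_fderiv.symm
  have hm : Measurable fun x => lineDeriv ℝ v x h := measurable_lineDeriv hv.continuous
  rw [eLpNorm_congr_ae hae, eLpNorm_ofReal_le_iff hp]
  calc ∫⁻ x, ‖v (x + h) - v x‖ₑ ^ p ∂μ
      ≤ ∫⁻ x, (∫⁻ t in Ioc (0 : ℝ) 1, ‖lineDeriv ℝ v (x + t • h) h‖ₑ ^ p) ∂μ := by
        refine lintegral_mono fun x => ?_
        rw [hv.add_sub_eq_integral_lineDeriv]
        exact enorm_intervalIntegral_zero_one_rpow_le hp (hm.comp (by fun_prop))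
    _ = ∫⁻ t in Ioc (0 : ℝ) 1, ∫⁻ x, ‖lineDeriv ℝ v (x + t • h) h‖ₑ ^ p ∂μ := by
        refine lintegral_lintegral_swap (Measurable.aemeasurable ?_)
        exact ((hm.comp (f := fun q : E × ℝ => q.1 + q.2 • h) (by fun_prop)).enorm).pow_const p
    _ = ∫⁻ t in Ioc (0 : ℝ) 1, ∫⁻ x, ‖lineDeriv ℝ v x h‖ₑ ^ p ∂μ := by
        refine lintegral_congr fun t => ?_
        exact lintegral_add_right_eq_self (fun x => ‖lineDeriv ℝ v x h‖ₑ ^ p) (t • h)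
    _ = _ := by simp

theorem LipschitzWith.ae_fderiv_sub {u v : E → ℝ} {K L : ℝ≥0} (hu : LipschitzWith K u)
    (hv : LipschitzWith L v) :
    fderiv ℝ (u - v) =ᵐ[μ] fderiv ℝ u - fderiv ℝ v := by
  filter_upwards [hu.ae_differentiableAt, hv.ae_differentiableAt] with x hx hy
  exact fderiv_sub hx hy

/-- `g` is the `L^p`-limit of the gradients of a sequence of Lipschitz functions that converges to
`f` in `L^p`. -/
structure IsStrongGradient (μ : Measure E) (p : ℝ) (f : E → ℝ) (g : E → E →L[ℝ] ℝ)
    (v : ℕ → E → ℝ) : Prop where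
  memLp_fun : MemLp f (ENNReal.ofReal p) μ
  memLp_grad : MemLp g (ENNReal.ofReal p) μ
  lipschitz : ∀ k, ∃ K : ℝ≥0, LipschitzWith K (v k)
  tendsto_fun : Tendsto (fun k => eLpNorm (v k - f) (ENNReal.ofReal p) μ) atTop (𝓝 0)
  tendsto_grad : Tendsto (fun k => eLpNorm (fderiv ℝ (v k) - g) (ENNReal.ofReal p) μ) atTop (𝓝 0)

namespace IsStrongGradient

variable {μ} {f : E → ℝ} {g : E → E →L[ℝ] ℝ} {v : ℕ → E → ℝ}

omit [μ.IsAddHaarMeasure] in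
theorem aestronglyMeasurable_approx (H : IsStrongGradient μ p f g v) (k : ℕ) :
    AEStronglyMeasurable (v k) μ := by
  have : ProperSpace E := FiniteDimensional.proper ℝ E
  obtain ⟨K, hK⟩ := H.lipschitz k
  exact hK.continuous.aestronglyMeasurable

/-- Compare f - v_k with the Lipschitz function v_j - v_k: the remainder costs 2‖v_j - f‖_p, which
vanishes as j → ∞ for fixed h. The surviving bound is linear in ‖h‖, so it remains bounded after
division by the step length. -/
theorem eLpNorm_add_sub_sub_le (H : IsStrongGradient μ p f g v) (hp : 1 ≤ p) (k : ℕ) (h : E) :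
    eLpNorm (fun x => (f - v k) (x + h) - (f - v k) x) (ENNReal.ofReal p) μ ≤
      ‖h‖ₑ * eLpNorm (fderiv ℝ (v k) - g) (ENNReal.ofReal p) μ := by
  set q := ENNReal.ofReal p with hq
  have hq1 : 1 ≤ q := by simpa [hq] using hp
  have hf := H.memLp_fun.1
  have hg := H.memLp_grad.1
  have hv := H.aestronglyMeasurable_approx
  have key : ∀ j, eLpNorm (fun x => (f - v k) (x + h) - (f - v k) x) q μ ≤
      2 * eLpNorm (v j - f) q μ + ‖h‖ₑ * (eLpNorm (fderiv ℝ (v j) - g) q μ +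
        eLpNorm (fderiv ℝ (v k) - g) q μ) := by
    intro j
    obtain ⟨K, hK⟩ := H.lipschitz k
    obtain ⟨L, hL⟩ := H.lipschitz j
    have hmp := measurePreserving_add_right μ h
    have hm1 : AEStronglyMeasurable (fun x => (f - v j) (x + h) - (f - v j) x) μ :=
      ((hf.sub (hv j)).comp_measurePreserving hmp).sub (hf.sub (hv j))
    have hm2 : AEStronglyMeasurable (fun x => (v j - v k) (x + h) - (v j - v k) x) μ :=
      (((hv j).sub (hv k)).comp_measurePreserving hmp).sub ((hv j).sub (hv k))
    have heq : (fun x => (f - v k) (x + h) - (f - v k) x) =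
        (fun x => (f - v j) (x + h) - (f - v j) x) +
          fun x => (v j - v k) (x + h) - (v j - v k) x := by
      funext x; simp only [Pi.sub_apply, Pi.add_apply]; ring
    rw [heq]
    refine (eLpNorm_add_le hm1 hm2 hq1).trans (add_le_add ?_ ?_)
    · rw [eLpNorm_sub_comm]
      exact eLpNorm_add_sub_le_two_mul μ hp (hf.sub (hv j)) h
    · refine ((hL.sub hK).eLpNorm_add_sub_le μ hp h).trans ?_
      refine (eLpNorm_apply_le μ q _ h).trans (mul_le_mul_right ?_ _)
      have hae : fderiv ℝ (fun x => v j x - v k x) =ᵐ[μ] (fderiv ℝ (v j) - g) - (fderiv ℝ (v k) - g) := by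
        filter_upwards [hL.ae_fderiv_sub μ hK] with x hx
        exact hx.trans (by simp)
      rw [eLpNorm_congr_ae hae]
      exact eLpNorm_sub_le ((aestronglyMeasurable_fderiv μ _).sub hg)
        ((aestronglyMeasurable_fderiv μ _).sub hg) hq1
  refine ge_of_tendsto' (x := atTop) (?_ : Tendsto _ _ _) key
  have h1 : Tendsto (fun j => 2 * eLpNorm (v j - f) q μ) atTop (𝓝 (2 * 0)) :=
    ENNReal.Tendsto.const_mul H.tendsto_fun (.inr ENNReal.ofNat_ne_top)
  have h2 := (H.tendsto_grad.add_const (eLpNorm (fderiv ℝ (v k) - g) q μ))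
  have h3 := ENNReal.Tendsto.const_mul (a := ‖h‖ₑ) h2 (.inr enorm_ne_top)
  simpa using h1.add h3

omit [μ.IsAddHaarMeasure] in
theorem eLpNorm_fderiv_apply_le (H : IsStrongGradient μ p f g v) (hp : 1 ≤ p) (k : ℕ) (h : E) :
    eLpNorm (fun x => fderiv ℝ (v k) x h) (ENNReal.ofReal p) μ ≤
      eLpNorm (fun x => g x h) (ENNReal.ofReal p) μ +
        ‖h‖ₑ * eLpNorm (fderiv ℝ (v k) - g) (ENNReal.ofReal p) μ := by
  have hg := H.memLp_grad.1
  have hd := (aestronglyMeasurable_fderiv μ (v k)).sub hg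
  have heq : (fun x => fderiv ℝ (v k) x h) =
      (fun x => g x h) + fun x => (fderiv ℝ (v k) - g) x h := by
    funext x; simp
  rw [heq]
  refine (eLpNorm_add_le (hg.apply_continuousLinearMap h) (hd.apply_continuousLinearMap h)
    (by simpa using hp)).trans ?_
  gcongr
  exact eLpNorm_apply_le μ _ _ h

omit [μ.IsAddHaarMeasure] in
theorem eLpNorm_apply_le_fderiv (H : IsStrongGradient μ p f g v) (hp : 1 ≤ p) (k : ℕ) (h : E) :
    eLpNorm (fun x => g x h) (ENNReal.ofReal p) μ ≤
      eLpNorm (fun x => fderiv ℝ (v k) x h) (ENNReal.ofReal p) μ +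
        ‖h‖ₑ * eLpNorm (fderiv ℝ (v k) - g) (ENNReal.ofReal p) μ := by
  have hg := H.memLp_grad.1
  have hv := aestronglyMeasurable_fderiv μ (v k)
  have heq : (fun x => g x h) =
      (fun x => fderiv ℝ (v k) x h) - fun x => (fderiv ℝ (v k) - g) x h := by
    funext x; simp
  rw [heq]
  refine (eLpNorm_sub_le (hv.apply_continuousLinearMap h)
    ((hv.sub hg).apply_continuousLinearMap h) (by simpa using hp)).trans ?_
  gcongr
  exact eLpNorm_apply_le μ _ _ h

theorem eLpNorm_add_sub_le (H : IsStrongGradient μ p f g v) (hp : 1 ≤ p) (h : E) :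
    eLpNorm (fun x => f (x + h) - f x) (ENNReal.ofReal p) μ ≤
      eLpNorm (fun x => g x h) (ENNReal.ofReal p) μ := by
  have hf := H.memLp_fun.1
  have key : ∀ k, eLpNorm (fun x => f (x + h) - f x) (ENNReal.ofReal p) μ ≤
      eLpNorm (fun x => g x h) (ENNReal.ofReal p) μ +
        ‖h‖ₑ * eLpNorm (fderiv ℝ (v k) - g) (ENNReal.ofReal p) μ +
        ‖h‖ₑ * eLpNorm (fderiv ℝ (v k) - g) (ENNReal.ofReal p) μ := by
    intro k
    obtain ⟨K, hK⟩ := H.lipschitz k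
    have hv := H.aestronglyMeasurable_approx k
    have heq : (fun x => f (x + h) - f x) = (fun x => v k (x + h) - v k x) +
        fun x => (f - v k) (x + h) - (f - v k) x := by
      funext x; simp only [Pi.sub_apply, Pi.add_apply]; ring
    rw [heq]
    refine (eLpNorm_add_le (aestronglyMeasurable_add_sub hv h)
      (aestronglyMeasurable_add_sub (hf.sub hv) h) (by simpa using hp)).trans ?_
    exact add_le_add ((hK.eLpNorm_add_sub_le μ hp h).trans (H.eLpNorm_fderiv_apply_le hp k h))
      (H.eLpNorm_add_sub_sub_le hp k h)
  refine ge_of_tendsto' (x := atTop) (?_ : Tendsto _ _ _) key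
  have h3 := ENNReal.Tendsto.const_mul (a := ‖h‖ₑ) H.tendsto_grad (.inr enorm_ne_top)
  simpa using (h3.const_add (eLpNorm (fun x => g x h) (ENNReal.ofReal p) μ)).add h3

end IsStrongGradient

variable (p) in
/-- Lower semicontinuity of the difference quotients of a Lipschitz function. -/
theorem LipschitzWith.eLpNorm_fderiv_le_liminf {u : E → ℝ} {K : ℝ≥0} (hu : LipschitzWith K u)
    (w : E) {r : ℕ → ℝ} (hr : Tendsto r atTop (𝓝[>] 0)) :
    eLpNorm (fun x => fderiv ℝ u x w) (ENNReal.ofReal p) μ ≤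
      liminf (fun n => eLpNorm (fun x => (r n)⁻¹ * (u (x + r n • w) - u x)) (ENNReal.ofReal p) μ)
        atTop := by
  refine Lp.eLpNorm_lim_le_liminf_eLpNorm (fun n => ?_) _ ?_
  · have := hu.continuous
    exact Continuous.aestronglyMeasurable (by fun_prop)
  · filter_upwards [hu.ae_differentiableAt] with x hx
    have := (hx.hasFDerivAt.hasLineDerivAt w).tendsto_slope_zero_right.comp hr
    simpa [Function.comp_def] using this

variable {μ} in
-- The upper bound already holds at every r > 0. The lower bound is Fatou for v_k, with an error
-- uniform in r, so that k → ∞ may be taken after r → 0.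
theorem IsStrongGradient.tendsto_eLpNorm {f : E → ℝ} {g : E → E →L[ℝ] ℝ} {v : ℕ → E → ℝ}
    (H : IsStrongGradient μ p f g v) (hp : 1 ≤ p) (w : E) :
    Tendsto (fun r : ℝ => eLpNorm (fun x => r⁻¹ * (f (x + r • w) - f x)) (ENNReal.ofReal p) μ)
      (𝓝[>] 0) (𝓝 (eLpNorm (fun x => g x w) (ENNReal.ofReal p) μ)) := by
  refine tendsto_of_seq_tendsto fun r hr => ?_
  have hr0 : ∀ᶠ n in atTop, 0 < r n := hr.eventually self_mem_nhdsWithin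
  set q := ENNReal.ofReal p with hq
  have hq1 : 1 ≤ q := by simpa [hq] using hp
  have hf := H.memLp_fun.1
  have hscale : ∀ {s : ℝ}, 0 < s → ∀ a : ℝ≥0∞,
      ENNReal.ofReal s⁻¹ * (‖s • w‖ₑ * a) = ‖w‖ₑ * a := by
    intro s hs a
    rw [enorm_smul, Real.enorm_of_nonneg hs.le, ← mul_assoc, ← mul_assoc,
      ← ENNReal.ofReal_mul (inv_nonneg.2 hs.le), inv_mul_cancel₀ hs.ne', ENNReal.ofReal_one, one_mul]
  refine tendsto_of_le_liminf_of_limsup_le ?_ ?_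
  -- One error comes from replacing g by the gradient of v_k, the other from replacing v_k by f in
  -- the quotients.
  · have key : ∀ k, eLpNorm (fun x => g x w) q μ ≤
        liminf (fun n => eLpNorm (fun x => (r n)⁻¹ * (f (x + r n • w) - f x)) q μ) atTop +
          ‖w‖ₑ * eLpNorm (fderiv ℝ (v k) - g) q μ +
          ‖w‖ₑ * eLpNorm (fderiv ℝ (v k) - g) q μ := by
      intro k
      obtain ⟨K, hK⟩ := H.lipschitz k
      refine (H.eLpNorm_apply_le_fderiv hp k w).trans ?_
      gcongr
      refine (hK.eLpNorm_fderiv_le_liminf μ p w hr).trans ?_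
      rw [← liminf_add_const _ _ _ (by isBoundedDefault) (by isBoundedDefault)]
      refine liminf_le_liminf ?_
      filter_upwards [hr0] with n hn
      have hv := H.aestronglyMeasurable_approx k
      have heq : (fun x => v k (x + r n • w) - v k x) = (fun x => f (x + r n • w) - f x) -
          fun x => (f - v k) (x + r n • w) - (f - v k) x := by
        funext x; simp only [Pi.sub_apply]; ring
      rw [eLpNorm_inv_mul_eq μ hn, eLpNorm_inv_mul_eq μ hn, heq,
        ← hscale hn, ← mul_add]
      gcongr
      refine (eLpNorm_sub_le (aestronglyMeasurable_add_sub hf _)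
        (aestronglyMeasurable_add_sub (hf.sub hv) _) hq1).trans ?_
      gcongr
      exact H.eLpNorm_add_sub_sub_le hp k _
    refine ge_of_tendsto' (x := atTop) (?_ : Tendsto _ _ _) key
    have h3 := ENNReal.Tendsto.const_mul (a := ‖w‖ₑ) H.tendsto_grad (.inr enorm_ne_top)
    simpa [Function.comp_def] using (h3.const_add _).add h3
  · refine limsup_le_of_le (by isBoundedDefault) ?_
    filter_upwards [hr0] with n hn
    rw [Function.comp_apply, eLpNorm_inv_mul_eq μ hn]
    refine (mul_le_mul_right (H.eLpNorm_add_sub_le hp _) _).trans ?_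
    have : (fun x => g x (r n • w)) = r n • fun x => g x w := by funext x; simp
    rw [this, eLpNorm_const_smul, Real.enorm_of_nonneg hn.le, ← mul_assoc,
      ← ENNReal.ofReal_mul (inv_nonneg.2 hn.le), inv_mul_cancel₀ hn.ne', ENNReal.ofReal_one, one_mul]

end DifferenceQuotient

/-! ### Uniform convexity of the p-th power, p > 1. -/

section UniformConvexity

/-- Strict convexity on [0, ∞) settles |a| ≠ |b|. If a = -b the midpoint is 0, and equality forces
both to vanish. -/
theorem two_mul_abs_half_add_rpow_le {p : ℝ} (hp : 1 < p) (a b : ℝ) :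
    2 * |(a + b) / 2| ^ p ≤ |a| ^ p + |b| ^ p ∧
      (2 * |(a + b) / 2| ^ p = |a| ^ p + |b| ^ p → a = b) := by
  have hp0 : 0 < p := one_pos.trans hp
  have h1 : |(a + b) / 2| ≤ (|a| + |b|) / 2 := by
    rw [abs_div, abs_two]; gcongr; exact abs_add_le a b
  have h2 : |(a + b) / 2| ^ p ≤ ((|a| + |b|) / 2) ^ p := by gcongr
  by_cases hab : |a| = |b|
  · refine ⟨by rw [hab] at h2 ⊢; rw [add_self_div_two] at h2; linarith, fun h => ?_⟩
    rcases abs_eq_abs.1 hab with h' | h'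
    · exact h'
    · have : (0 : ℝ) ≤ |b| ^ p := by positivity
      subst h'
      simp only [neg_add_cancel, zero_div, abs_zero, Real.zero_rpow hp0.ne', abs_neg] at h
      have hb : |b| ^ p = 0 := by linarith
      rw [Real.rpow_eq_zero (abs_nonneg b) hp0.ne', abs_eq_zero] at hb
      simp [hb]
  · have h3 := (strictConvexOn_rpow hp).2 (mem_Ici.2 (abs_nonneg a)) (mem_Ici.2 (abs_nonneg b)) hab
      (one_half_pos (α := ℝ)) one_half_pos (add_halves 1)
    simp only [smul_eq_mul] at h3
    have h4 : 1 / 2 * |a| + 1 / 2 * |b| = (|a| + |b|) / 2 := by ring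
    rw [h4] at h3
    exact ⟨by linarith, fun h => by linarith⟩

/-- Quantitative uniform convexity of `|·|^p` for `p > 1`. -/
theorem exists_abs_sub_rpow_le {p : ℝ} (hp : 1 < p) {ε : ℝ} (hε : 0 < ε) :
    ∃ C : ℝ, 0 ≤ C ∧ ∀ a b : ℝ,
      |a - b| ^ p + C * (2 * |(a + b) / 2| ^ p) ≤ (ε + C) * (|a| ^ p + |b| ^ p) := by
  have hp0 : 0 < p := one_pos.trans hp
  have hcont : ∀ φ : ℝ × ℝ → ℝ, Continuous φ → Continuous fun x => |φ x| ^ p :=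
    fun φ hφ => hφ.abs.rpow_const fun _ => .inr hp0.le
  -- The claim is G ≤ C F. Both sides are p-homogeneous, so the unit sphere of ℝ² suffices. Where G
  -- < 0 it holds since F ≥ 0. The set G ≥ 0 is compact there and F > 0 on it, since F = 0 forces a
  -- = b and then G < 0; so C = max G / min F works.
  set F : ℝ × ℝ → ℝ := fun x => |x.1| ^ p + |x.2| ^ p - 2 * |(x.1 + x.2) / 2| ^ p
  set G : ℝ × ℝ → ℝ := fun x => |x.1 - x.2| ^ p - ε * (|x.1| ^ p + |x.2| ^ p)
  have hF : Continuous F := ((hcont _ continuous_fst).add (hcont _ continuous_snd)).sub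
    ((hcont (fun x => (x.1 + x.2) / 2) (by fun_prop)).const_mul 2)
  have hG : Continuous G := (hcont (fun x => x.1 - x.2) (by fun_prop)).sub
    (((hcont _ continuous_fst).add (hcont _ continuous_snd)).const_mul ε)
  have hF0 : ∀ x, 0 ≤ F x := fun x => sub_nonneg.2 (two_mul_abs_half_add_rpow_le hp x.1 x.2).1
  have hS : IsCompact (sphere (0 : ℝ × ℝ) 1 ∩ {x | 0 ≤ G x}) :=
    (isCompact_sphere _ _).inter_right (isClosed_le continuous_const hG)
  obtain ⟨C, hC0, hC⟩ : ∃ C, 0 ≤ C ∧ ∀ x ∈ sphere (0 : ℝ × ℝ) 1, G x ≤ C * F x := by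
    rcases (sphere (0 : ℝ × ℝ) 1 ∩ {x | 0 ≤ G x}).eq_empty_or_nonempty with he | hne
    · refine ⟨0, le_rfl, fun x hx => ?_⟩
      by_contra! h
      rw [zero_mul] at h
      exact (he ▸ ⟨hx, h.le⟩ : x ∈ (∅ : Set (ℝ × ℝ)))
    · obtain ⟨y, hy, hymin⟩ := hS.exists_isMinOn hne hF.continuousOn
      obtain ⟨z, hz, hzmax⟩ := hS.exists_isMaxOn hne hG.continuousOn
      have hFy : 0 < F y := by
        refine (hF0 y).lt_of_ne fun h => ?_
        have hyy : y.1 = y.2 :=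
          (two_mul_abs_half_add_rpow_le hp y.1 y.2).2 (by simp only [F] at h; linarith)
        have hGy : 0 ≤ G y := hy.2
        have hy1 : |y.2| = 1 := by
          have := mem_sphere_zero_iff_norm.1 hy.1
          rw [Prod.norm_def, hyy, max_self] at this
          exact this
        simp only [G, hyy, sub_self, abs_zero, Real.zero_rpow hp0.ne', hy1, Real.one_rpow] at hGy
        linarith
      have hGz : 0 ≤ G z := hz.2
      refine ⟨G z / F y, by positivity, fun x hx => ?_⟩
      rcases lt_or_ge (G x) 0 with h | h
      · exact h.le.trans (mul_nonneg (by positivity) (hF0 x))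
      · have h1 : G x ≤ G z := hzmax ⟨hx, h⟩
        have h2 : F y ≤ F x := hymin ⟨hx, h⟩
        calc G x ≤ G z / F y * F y := by rwa [div_mul_cancel₀ _ hFy.ne']
          _ ≤ _ := by gcongr
  refine ⟨C, hC0, fun a b => ?_⟩
  suffices h : G (a, b) ≤ C * F (a, b) by simp only [F, G] at h; linarith
  by_cases h0 : (a, b) = (0 : ℝ × ℝ)
  · simp only [Prod.mk_eq_zero] at h0
    simp [F, G, h0.1, h0.2, Real.zero_rpow hp0.ne']
  · set t := ‖(a, b)‖
    have ht : 0 < t := norm_pos_iff.2 h0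
    have hx := hC (t⁻¹ • (a, b)) (by
      rw [mem_sphere_zero_iff_norm, norm_smul, norm_inv, norm_norm, inv_mul_cancel₀ ht.ne'])
    have hs : ∀ c : ℝ, |t⁻¹ * c| ^ p = (t⁻¹) ^ p * |c| ^ p := fun c => by
      rw [abs_mul, abs_of_pos (inv_pos.2 ht), Real.mul_rpow (inv_pos.2 ht).le (abs_nonneg c)]
    have hGs : G (t⁻¹ • (a, b)) = (t⁻¹) ^ p * G (a, b) := by
      simp only [G, Prod.smul_fst, Prod.smul_snd, smul_eq_mul, ← mul_sub, hs]; ring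
    have hFs : F (t⁻¹ • (a, b)) = (t⁻¹) ^ p * F (a, b) := by
      simp only [F, Prod.smul_fst, Prod.smul_snd, smul_eq_mul, ← mul_add, hs, mul_div_assoc]; ring
    rw [hGs, hFs, mul_left_comm] at hx
    exact le_of_mul_le_mul_left hx (Real.rpow_pos_of_pos (inv_pos.2 ht) p)

theorem exists_enorm_sub_rpow_le {p : ℝ} (hp : 1 < p) {ε : ℝ≥0} (hε : 0 < ε) :
    ∃ C : ℝ≥0, ∀ a b : ℝ, ‖a - b‖ₑ ^ p + C * (2 * ‖(2 : ℝ)⁻¹ • (a + b)‖ₑ ^ p) ≤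
      (ε + C) * (‖a‖ₑ ^ p + ‖b‖ₑ ^ p) := by
  obtain ⟨C, hC0, hC⟩ := exists_abs_sub_rpow_le hp (NNReal.coe_pos.2 hε)
  lift C to ℝ≥0 using hC0
  refine ⟨C, fun a b => ?_⟩
  have hn : ∀ c : ℝ, ‖c‖ₑ ^ p = ((‖c‖₊ ^ p : ℝ≥0) : ℝ≥0∞) := fun c => by
    rw [enorm_eq_nnnorm, ENNReal.coe_rpow_of_nonneg _ (one_pos.trans hp).le]
  have h := hC a b
  simp only [hn]
  norm_cast
  rw [← NNReal.coe_le_coe]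
  push_cast
  simpa [div_eq_inv_mul, mul_add] using h

end UniformConvexity

/-! ### The coordinate energy of a gradient. -/

section Sobolev

variable {E : Type*} [NormedAddCommGroup E] [NormedSpace ℝ E]

theorem enorm_fderiv_le_localLip {u : E → ℝ} {x : E}
    (hu : DifferentiableAt ℝ u x) : ‖fderiv ℝ u x‖ₑ ≤ localLip u x := by
  have key : ∀ w : E, ‖fderiv ℝ u x w‖ₑ ≤ localLip u x * ‖w‖ₑ := by
    intro w
    rcases eq_or_ne w 0 with rfl | hw
    · simp
    have hw0 : 0 < ‖w‖ := norm_pos_iff.2 hw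
    have h1 := (hu.hasFDerivAt.hasLineDerivAt w).tendsto_slope_zero_right
    have h2 : Tendsto (fun t : ℝ => x + t • w) (𝓝[>] 0) (𝓝[≠] x) := by
      refine tendsto_nhdsWithin_iff.2 ⟨?_, ?_⟩
      · have : Continuous fun t : ℝ => x + t • w := by fun_prop
        simpa using (this.tendsto 0).mono_left nhdsWithin_le_nhds
      · filter_upwards [self_mem_nhdsWithin] with t ht
        simp [hw, (mem_Ioi.1 ht).ne']
    have h3 : Tendsto (fun t : ℝ => ENNReal.ofReal (|u (x + t • w) - u x| / dist x (x + t • w)))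
        (𝓝[>] 0) (𝓝 (ENNReal.ofReal (|fderiv ℝ u x w| / ‖w‖))) := by
      refine ENNReal.tendsto_ofReal ((h1.abs.div_const ‖w‖).congr' ?_)
      filter_upwards [self_mem_nhdsWithin] with t ht
      have ht : 0 < t := ht
      rw [smul_eq_mul, abs_mul, abs_of_pos (inv_pos.2 ht), dist_self_add_right,
        norm_smul, Real.norm_of_nonneg ht.le]
      field_simp
    have h4 : ENNReal.ofReal (|fderiv ℝ u x w| / ‖w‖) ≤ localLip u x := by
      rw [← h3.limsup_eq, localLip]
      exact h2.limsup_comp_le_limsup (u := fun y => ENNReal.ofReal (|u y - u x| / dist x y))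
    calc ‖fderiv ℝ u x w‖ₑ = ENNReal.ofReal (|fderiv ℝ u x w| / ‖w‖) * ‖w‖ₑ := by
          rw [← ofReal_norm w, ← ENNReal.ofReal_mul (by positivity),
            div_mul_cancel₀ _ hw0.ne', ← Real.norm_eq_abs, ofReal_norm]
      _ ≤ _ := by gcongr
  rcases eq_or_ne (localLip u x) ⊤ with h | h
  · simp [h]
  lift localLip u x to ℝ≥0 using h with c
  have : ‖fderiv ℝ u x‖ ≤ c := ContinuousLinearMap.opNorm_le_bound _ c.2 fun w => by
    have := key w
    simp only [enorm_eq_nnnorm] at this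
    exact_mod_cast this
  rw [enorm_eq_nnnorm]
  exact_mod_cast this

variable [FiniteDimensional ℝ E] [MeasurableSpace E] (μ : Measure E)

/-- The energy `∑ i, ∫ |∂ᵢ v|^p`, the sum running over a basis. -/
noncomputable def coordEnergy (p : ℝ) (v : E → ℝ) : ℝ≥0∞ :=
  ∑ i, ∫⁻ x, ‖fderiv ℝ v x (Module.finBasis ℝ E i)‖ₑ ^ p ∂μ

variable [BorelSpace E] {p : ℝ}

/-- Carries the bound on local Lipschitz constants over to the energy to which scalar uniform
convexity applies; `exists_eLpNorm_le_rpow` converts back to the operator norm. -/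
theorem exists_coordEnergy_le [μ.IsAddHaarMeasure] (hp : 1 ≤ p) :
    ∃ C : ℝ≥0∞, C ≠ ⊤ ∧ ∀ (v : E → ℝ) (K : ℝ≥0), LipschitzWith K v →
      coordEnergy μ p v ≤ C * ∫⁻ x, localLip v x ^ p ∂μ := by
  have hp0 : 0 ≤ p := zero_le_one.trans hp
  refine ⟨∑ i, ‖Module.finBasis ℝ E i‖ₑ ^ p, ?_, fun v K hv => ?_⟩
  · exact (ENNReal.sum_lt_top.2 fun i _ => ENNReal.rpow_lt_top_of_nonneg hp0 enorm_ne_top).ne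
  · rw [coordEnergy, Finset.sum_mul]
    refine Finset.sum_le_sum fun i _ => ?_
    rw [← lintegral_const_mul' _ _ (ENNReal.rpow_lt_top_of_nonneg hp0 enorm_ne_top).ne]
    refine lintegral_mono_ae ?_
    filter_upwards [hv.ae_differentiableAt] with x hx
    rw [← ENNReal.mul_rpow_of_nonneg _ _ hp0, mul_comm]
    exact ENNReal.rpow_le_rpow (((fderiv ℝ v x).le_opENorm _).trans
      (mul_le_mul_left (enorm_fderiv_le_localLip hx) _)) hp0

omit [BorelSpace E] in
theorem exists_eLpNorm_le_sum (hp : 1 ≤ p) :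
    ∃ C : ℝ≥0, ∀ g : E → E →L[ℝ] ℝ, AEStronglyMeasurable g μ →
      eLpNorm g (ENNReal.ofReal p) μ ≤
        C * ∑ i, eLpNorm (fun x => g x (Module.finBasis ℝ E i)) (ENNReal.ofReal p) μ := by
  obtain ⟨C, hC0, hC⟩ := (Module.finBasis ℝ E).exists_opNorm_le (F := ℝ)
  lift C to ℝ≥0 using hC0.le
  refine ⟨C, fun g hg => ?_⟩
  set S : E → ℝ := fun x => ∑ i, ‖g x (Module.finBasis ℝ E i)‖ with hS
  have h1 : eLpNorm g (ENNReal.ofReal p) μ ≤ C * eLpNorm S (ENNReal.ofReal p) μ := by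
    have := eLpNorm_le_nnreal_smul_eLpNorm_of_ae_le_mul (μ := μ) (f := g) (g := S) (c := C)
      (.of_forall fun x => by
        rw [← NNReal.coe_le_coe]
        push_cast
        have hSx : 0 ≤ S x := Finset.sum_nonneg fun i _ => norm_nonneg _
        rw [Real.norm_of_nonneg hSx]
        exact hC hSx fun i => Finset.single_le_sum
          (f := fun i => ‖g x (Module.finBasis ℝ E i)‖) (fun i _ => norm_nonneg _)
          (Finset.mem_univ i)) (ENNReal.ofReal p)
    simpa only [ENNReal.smul_def, smul_eq_mul] using this
  refine h1.trans ?_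
  gcongr
  have h2 : S = ∑ i, fun x => ‖g x (Module.finBasis ℝ E i)‖ := by
    funext x; simp [hS]
  rw [h2]
  refine (eLpNorm_sum_le (fun i _ => (hg.apply_continuousLinearMap _).norm)
    (by simpa using hp)).trans (Finset.sum_le_sum fun i _ => ?_)
  rw [eLpNorm_norm]

omit [BorelSpace E] in
theorem exists_eLpNorm_le_rpow (hp : 1 ≤ p) :
    ∃ C : ℝ≥0, ∀ g : E → E →L[ℝ] ℝ, AEStronglyMeasurable g μ →
      eLpNorm g (ENNReal.ofReal p) μ ≤
        C * (∑ i, ∫⁻ x, ‖g x (Module.finBasis ℝ E i)‖ₑ ^ p ∂μ) ^ p⁻¹ := by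
  obtain ⟨C, hC⟩ := exists_eLpNorm_le_sum (E := E) μ hp
  have hp0 : 0 < p := one_pos.trans_le hp
  refine ⟨C * Module.finrank ℝ E, fun g hg => (hC g hg).trans ?_⟩
  rw [ENNReal.coe_mul, mul_assoc]
  gcongr
  set R := ∑ i, ∫⁻ x, ‖g x (Module.finBasis ℝ E i)‖ₑ ^ p ∂μ with hR
  calc _ ≤ ∑ i : Fin (Module.finrank ℝ E), R ^ p⁻¹ := by
        refine Finset.sum_le_sum fun i _ => ?_
        rw [ENNReal.le_rpow_inv_iff hp0, eLpNorm_ofReal_rpow hp, hR]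
        exact Finset.single_le_sum
          (f := fun i => ∫⁻ x, ‖g x (Module.finBasis ℝ E i)‖ₑ ^ p ∂μ)
          (fun i _ => zero_le) (Finset.mem_univ i)
    _ = _ := by simp

variable [μ.IsAddHaarMeasure]

/-- The scalar inequality, integrated in each basis direction: almost everywhere the gradient of the
midpoint is the midpoint of the gradients. -/
theorem sum_lintegral_sub_add_le {ε C : ℝ≥0}
    (hC : ∀ a b : ℝ, ‖a - b‖ₑ ^ p + C * (2 * ‖(2 : ℝ)⁻¹ • (a + b)‖ₑ ^ p) ≤
      (ε + C) * (‖a‖ₑ ^ p + ‖b‖ₑ ^ p))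
    {u v : E → ℝ} {K L : ℝ≥0} (hu : LipschitzWith K u) (hv : LipschitzWith L v) :
    (∑ i, ∫⁻ x, ‖(fderiv ℝ u - fderiv ℝ v) x (Module.finBasis ℝ E i)‖ₑ ^ p ∂μ) +
      C * (2 * coordEnergy μ p ((2 : ℝ)⁻¹ • (u + v))) ≤
      (ε + C) * (coordEnergy μ p u + coordEnergy μ p v) := by
  have hm : ∀ (w : E → ℝ) (i), AEMeasurable
      (fun x => ‖fderiv ℝ w x (Module.finBasis ℝ E i)‖ₑ ^ p) μ := fun w i =>
    ((aestronglyMeasurable_fderiv μ w).apply_continuousLinearMap _).enorm.pow_const p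
  simp only [coordEnergy]
  rw [← Finset.sum_add_distrib, Finset.mul_sum, Finset.mul_sum, Finset.mul_sum,
    ← Finset.sum_add_distrib]
  refine Finset.sum_le_sum fun i _ => ?_
  rw [← lintegral_add_left' (hm u i), ← lintegral_const_mul'' (↑ε + ↑C) ((hm u i).fun_add (hm v i)),
    ← lintegral_const_mul'' _ (hm _ i), ← lintegral_const_mul'' _ ((hm _ i).const_mul 2),
    ← lintegral_add_right' _ (((hm _ i).const_mul 2).const_mul _)]
  refine lintegral_mono_ae ?_
  filter_upwards [hu.ae_differentiableAt, hv.ae_differentiableAt] with x hx hy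
  rw [fderiv_const_smul (hx.add hy), fderiv_add hx hy]
  exact hC _ _

end Sobolev

/-! ### Existence of strong gradients, and their relation to weak gradients. -/

section Sobolev

variable {E : Type*} [NormedAddCommGroup E] [NormedSpace ℝ E] [FiniteDimensional ℝ E]
  [MeasurableSpace E] [BorelSpace E] (μ : Measure E) [μ.IsAddHaarMeasure] {p : ℝ}

/-- The Lipschitz functions at `L^p`-distance at most `ε` from `f`. -/
def lipschitzNear {E : Type*} [NormedAddCommGroup E] [MeasurableSpace E] (μ : Measure E) (p : ℝ) (f : E → ℝ) (ε : ℝ≥0∞) : Set (E → ℝ) :=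
  {v | (∃ K : ℝ≥0, LipschitzWith K v) ∧ eLpNorm (v - f) (ENNReal.ofReal p) μ ≤ ε}

variable {μ}

theorem lipschitzNear_mono {E : Type*} [NormedAddCommGroup E] [MeasurableSpace E] {μ : Measure E}
    {p : ℝ} {f : E → ℝ} {ε δ : ℝ≥0∞} (h : ε ≤ δ) :
    lipschitzNear μ p f ε ⊆ lipschitzNear μ p f δ :=
  fun _ hv => ⟨hv.1, hv.2.trans h⟩

omit [μ.IsAddHaarMeasure] in
theorem midpoint_mem_lipschitzNear (hp : 1 ≤ p) {f : E → ℝ} (hf : AEStronglyMeasurable f μ)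
    {ε : ℝ≥0∞} {u v : E → ℝ} (hu : u ∈ lipschitzNear μ p f ε) (hv : v ∈ lipschitzNear μ p f ε) :
    (2 : ℝ)⁻¹ • (u + v) ∈ lipschitzNear μ p f ε := by
  have : ProperSpace E := FiniteDimensional.proper ℝ E
  obtain ⟨⟨K, hK⟩, hu⟩ := hu
  obtain ⟨⟨L, hL⟩, hv⟩ := hv
  refine ⟨⟨_, (lipschitzWith_smul (2 : ℝ)⁻¹).comp (hK.add hL)⟩, ?_⟩
  have heq : (2 : ℝ)⁻¹ • (u + v) - f = (2 : ℝ)⁻¹ • ((u - f) + (v - f)) := by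
    funext x
    simp only [Pi.sub_apply, Pi.smul_apply, Pi.add_apply, smul_eq_mul]
    ring
  rw [heq, eLpNorm_const_smul]
  have h2 : ‖(2 : ℝ)⁻¹‖ₑ = 2⁻¹ := by
    rw [enorm_inv two_ne_zero]; simp [enorm_eq_nnnorm]
  calc _ ≤ ‖(2 : ℝ)⁻¹‖ₑ * (ε + ε) := by
        gcongr
        exact (eLpNorm_add_le (hK.continuous.aestronglyMeasurable.sub hf)
          (hL.continuous.aestronglyMeasurable.sub hf) (by simpa using hp)).trans (add_le_add hu hv)
    _ = ε := by
        rw [h2, ← two_mul, ← mul_assoc, ENNReal.inv_mul_cancel two_ne_zero ENNReal.ofNat_ne_top,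
          one_mul]

/-- Almost minimizers of the energy form a Cauchy sequence. -/
theorem tendsto_energy_sub_of_almost_minimizer (hp : 1 < p) {f : E → ℝ}
    (hf : AEStronglyMeasurable f μ) {ε : ℕ → ℝ≥0∞} (hε : Antitone ε) {d : ℕ → ℝ≥0∞}
    (hd : ∀ k, ∀ w ∈ lipschitzNear μ p f (ε k), d k ≤ coordEnergy μ p w)
    {D : ℝ≥0∞} (hD : D ≠ ⊤) (hdD : Tendsto d atTop (𝓝 D)) {v : ℕ → E → ℝ}
    (hv : ∀ k, v k ∈ lipschitzNear μ p f (ε k)) {J : ℕ → ℝ≥0∞} (hJ : Tendsto J atTop (𝓝 D))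
    (hvJ : ∀ N k, N ≤ k → coordEnergy μ p (v k) ≤ J N) {η : ℝ≥0∞} (hη : 0 < η) :
    ∃ N, ∀ j k, N ≤ j → N ≤ k →
      ∑ i, ∫⁻ x, ‖(fderiv ℝ (v j) - fderiv ℝ (v k)) x (Module.finBasis ℝ E i)‖ₑ ^ p ∂μ ≤ η := by
  -- For j, k ≥ N the midpoint of v_j and v_k has energy at least d N, so uniform convexity bounds
  -- the energy of the difference by (e + C) 2 J N - C 2 d N. This tends to 2eD, which e is chosen
  -- to keep below η.
  obtain ⟨e, he0, he⟩ : ∃ e : ℝ≥0, 0 < e ∧ (e : ℝ≥0∞) * (2 * D) < η := by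
    rcases eq_or_ne D 0 with h | h
    · exact ⟨1, one_pos, by simpa [h] using hη⟩
    · have h2D : 2 * D ≠ ⊤ := ENNReal.mul_ne_top ENNReal.ofNat_ne_top hD
      have h2D0 : 2 * D ≠ 0 := mul_ne_zero two_ne_zero h
      obtain ⟨e, he0, he⟩ := ENNReal.lt_iff_exists_nnreal_btwn.1 (ENNReal.div_pos hη.ne' h2D)
      exact ⟨e, by simpa using he0, (ENNReal.lt_div_iff_mul_lt (.inl h2D0) (.inl h2D)).1 he⟩
  obtain ⟨C, hC⟩ := exists_enorm_sub_rpow_le hp he0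
  have hlim1 : Tendsto (fun N => ((e : ℝ≥0∞) + C) * (2 * J N)) atTop
      (𝓝 ((e + C) * (2 * D))) :=
    ENNReal.Tendsto.const_mul (ENNReal.Tendsto.const_mul hJ (.inr ENNReal.ofNat_ne_top))
      (.inr (ENNReal.add_ne_top.2 ⟨ENNReal.coe_ne_top, ENNReal.coe_ne_top⟩))
  have hlim2 : Tendsto (fun N => η + C * (2 * d N)) atTop (𝓝 (η + C * (2 * D))) :=
    (ENNReal.Tendsto.const_mul (ENNReal.Tendsto.const_mul hdD (.inr ENNReal.ofNat_ne_top))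
      (.inr ENNReal.coe_ne_top)).const_add η
  have hCD : (C : ℝ≥0∞) * (2 * D) ≠ ⊤ :=
    ENNReal.mul_ne_top ENNReal.coe_ne_top (ENNReal.mul_ne_top ENNReal.ofNat_ne_top hD)
  have hlt : ((e : ℝ≥0∞) + C) * (2 * D) < η + C * (2 * D) := by
    rw [add_mul]
    exact ENNReal.add_lt_add_right hCD he
  have hdle : ∀ᶠ N in atTop, C * (2 * d N) ≠ ⊤ := by
    filter_upwards [hdD.eventually_ne hD] with N hN
    exact ENNReal.mul_ne_top ENNReal.coe_ne_top (ENNReal.mul_ne_top ENNReal.ofNat_ne_top hN)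
  obtain ⟨N, hN, hNd⟩ := ((hlim1.eventually_lt hlim2 hlt).and hdle).exists
  refine ⟨N, fun j k hj hk => ?_⟩
  obtain ⟨⟨K, hK⟩, -⟩ := hv j
  obtain ⟨⟨L, hL⟩, -⟩ := hv k
  refine (ENNReal.add_le_add_iff_right hNd).1 ?_
  calc _ ≤ _ + C * (2 * coordEnergy μ p ((2 : ℝ)⁻¹ • (v j + v k))) := by
        gcongr
        exact hd N _ (midpoint_mem_lipschitzNear hp.le hf (lipschitzNear_mono (hε hj) (hv j))
          (lipschitzNear_mono (hε hk) (hv k)))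
    _ ≤ (e + C) * (coordEnergy μ p (v j) + coordEnergy μ p (v k)) :=
        sum_lintegral_sub_add_le μ hC hK hL
    _ ≤ (e + C) * (2 * J N) := by
        rw [two_mul]
        gcongr
        · exact hvJ N j hj
        · exact hvJ N k hk
    _ ≤ _ := hN.le

theorem exists_tendsto_eLpNorm_of_cauchy {F : Type*} [NormedAddCommGroup F] [CompleteSpace F]
    {α : Type*} [MeasurableSpace α] {μ : Measure α} {q : ℝ≥0∞} (hq : 1 ≤ q) {G : ℕ → α → F}
    (hG : ∀ k, MemLp (G k) q μ)
    (hc : ∀ η : ℝ≥0∞, 0 < η → ∃ N, ∀ j k, N ≤ j → N ≤ k → eLpNorm (G j - G k) q μ < η) :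
    ∃ g, MemLp g q μ ∧ Tendsto (fun k => eLpNorm (G k - g) q μ) atTop (𝓝 0) := by
  have : Fact (1 ≤ q) := ⟨hq⟩
  have hcs : CauchySeq fun k => (hG k).toLp (G k) := by
    rw [EMetric.cauchySeq_iff]
    intro η hη
    obtain ⟨N, hN⟩ := hc η hη
    exact ⟨N, fun j hj k hk => by rw [Lp.edist_toLp_toLp]; exact hN j k hj hk⟩
  obtain ⟨g, hg⟩ := cauchySeq_tendsto_of_complete hcs
  refine ⟨g, Lp.memLp g, ?_⟩
  rw [Lp.tendsto_Lp_iff_tendsto_eLpNorm'] at hg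
  refine hg.congr fun k => eLpNorm_congr_ae ?_
  filter_upwards [(hG k).coeFn_toLp] with x hx
  simp [hx]

/-- The infimal energies d k over shrinking L^p-balls increase to a finite D, because the given
sequence enters every ball with bounded energy. Almost minimizers then have Cauchy gradients, and
completeness of L^p provides g. -/
theorem MemMetricSobolev.exists_isStrongGradient (hp : 1 < p) {f : E → ℝ}
    (hf : MemMetricSobolev μ p f) : ∃ g v, IsStrongGradient μ p f g v := by
  have hp0 : 0 < p := one_pos.trans hp
  obtain ⟨hfp, u, hu, huf, hlim⟩ := hf
  obtain ⟨c, hc, hcu⟩ := exists_coordEnergy_le μ hp.le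
  -- A finite liminf bounds the energy only along infinitely many k.
  obtain ⟨M, hM⟩ : ∃ M : ℝ≥0, ∃ᶠ k in atTop, ∫⁻ x, localLip (u k) x ^ p ∂μ < M := by
    obtain ⟨M, hM, -⟩ := ENNReal.lt_iff_exists_nnreal_btwn.1 hlim
    exact ⟨M, frequently_lt_of_liminf_lt (by isBoundedDefault) hM⟩
  -- This serves both as the L^p-radius and as the slack in the minimization; the shift by 1 keeps
  -- `ε 0` finite.
  set ε : ℕ → ℝ≥0∞ := fun k => ((k : ℝ≥0∞) + 1)⁻¹ with hεdef
  have hε : Antitone ε := fun j k hjk => by simp only [hεdef]; gcongr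
  have hε0 : Tendsto ε atTop (𝓝 0) := by
    have := (tendsto_add_atTop_iff_nat 1).2 ENNReal.tendsto_inv_nat_nhds_zero
    simpa [hεdef] using this
  have hεpos : ∀ k, 0 < ε k := fun k => ENNReal.inv_pos.2 (by finiteness)
  set d : ℕ → ℝ≥0∞ := fun k => ⨅ w ∈ lipschitzNear μ p f (ε k), coordEnergy μ p w with hd
  have hdmono : Monotone d := fun j k hjk =>
    biInf_mono (lipschitzNear_mono (hε hjk))
  have hdM : ∀ k, d k ≤ c * M := by
    intro k
    obtain ⟨m, hm, hm'⟩ := (hM.and_eventually (huf.eventually_le_const (hεpos k))).exists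
    obtain ⟨K, hK⟩ := hu m
    refine (iInf₂_le (u m) ⟨⟨K, hK⟩, hm'⟩).trans ((hcu _ K hK).trans ?_)
    gcongr
  set D := ⨆ k, d k with hDdef
  have hcM : c * M ≠ ⊤ := ENNReal.mul_ne_top hc ENNReal.coe_ne_top
  have hD : D ≠ ⊤ := ne_top_of_le_ne_top hcM (iSup_le hdM)
  have hdD : Tendsto d atTop (𝓝 D) := tendsto_atTop_iSup hdmono
  have hex : ∀ k, ∃ w ∈ lipschitzNear μ p f (ε k), coordEnergy μ p w < d k + ε k := by
    intro k
    have : d k < d k + ε k :=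
      ENNReal.lt_add_right (ne_top_of_le_ne_top hcM (hdM k)) (hεpos k).ne'
    simpa only [hd, iInf_lt_iff, exists_prop] using this
  choose v hv hvd using hex
  have hJ : Tendsto (fun N => D + ε N) atTop (𝓝 D) := by simpa using hε0.const_add D
  have hvJ : ∀ N k, N ≤ k → coordEnergy μ p (v k) ≤ D + ε N := fun N k hNk =>
    (hvd k).le.trans (add_le_add (le_iSup d k) (hε hNk))
  obtain ⟨C, hC⟩ := exists_eLpNorm_le_rpow (E := E) μ hp.le
  have hLp : ∀ k, MemLp (fderiv ℝ (v k)) (ENNReal.ofReal p) μ := by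
    intro k
    refine ⟨aestronglyMeasurable_fderiv μ _, ((hC _ (aestronglyMeasurable_fderiv μ _)).trans_lt ?_)⟩
    refine ENNReal.mul_lt_top ENNReal.coe_lt_top (ENNReal.rpow_lt_top_of_nonneg (by positivity) ?_)
    refine ne_top_of_le_ne_top ?_ (hvJ 0 k (zero_le))
    exact ENNReal.add_ne_top.2 ⟨hD, by simp [hεdef]⟩
  obtain ⟨g, hg, hvg⟩ := exists_tendsto_eLpNorm_of_cauchy (by simpa using hp.le) hLp (by
    intro η hη
    have hlimη : Tendsto (fun t : ℝ≥0∞ => C * t ^ p⁻¹) (𝓝[>] 0) (𝓝 0) := by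
      have h1 : Tendsto (fun t : ℝ≥0∞ => t ^ p⁻¹) (𝓝[>] 0) (𝓝 0) := by
        have := (ENNReal.continuous_rpow_const (y := p⁻¹)).tendsto 0
        rw [ENNReal.zero_rpow_of_pos (inv_pos.2 hp0)] at this
        exact this.mono_left nhdsWithin_le_nhds
      simpa using ENNReal.Tendsto.const_mul h1 (.inr ENNReal.coe_ne_top)
    obtain ⟨t, htη, ht⟩ := ((hlimη.eventually_lt_const hη).and self_mem_nhdsWithin).exists
    obtain ⟨N, hN⟩ := tendsto_energy_sub_of_almost_minimizer hp hfp.1 hε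
      (fun k w hw => iInf₂_le w hw) hD hdD hv hJ hvJ (mem_Ioi.1 ht)
    refine ⟨N, fun j k hj hk => lt_of_le_of_lt (hC _ ((aestronglyMeasurable_fderiv μ _).sub
      (aestronglyMeasurable_fderiv μ _))) (lt_of_le_of_lt ?_ htη)⟩
    gcongr
    exact hN j k hj hk)
  exact ⟨g, v, hfp, hg, fun k => (hv k).1, tendsto_of_tendsto_of_tendsto_of_le_of_le
    tendsto_const_nhds hε0 (fun _ => zero_le) (fun k => (hv k).2), hvg⟩

theorem eLpNorm_sub_self {α F : Type*} [MeasurableSpace α] [NormedAddCommGroup F] (μ : Measure α)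
    (q : ℝ≥0∞) (h : α → F) : eLpNorm (h - h) q μ = 0 := by
  simp

theorem LipschitzWith.isStrongGradient {f : E → ℝ} {K : ℝ≥0} (hf : LipschitzWith K f)
    (hfc : HasCompactSupport f) (p : ℝ) :
    IsStrongGradient μ p f (fderiv ℝ f) fun _ => f where
  memLp_fun := hf.continuous.memLp_of_hasCompactSupport hfc
  memLp_grad := (hfc.fderiv (𝕜 := ℝ)).memLp_of_bound (aestronglyMeasurable_fderiv μ f) K
    (.of_forall fun _ => norm_fderiv_le_of_lipschitz ℝ hf)
  lipschitz _ := ⟨K, hf⟩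
  tendsto_fun := by simp
  tendsto_grad := tendsto_const_nhds.congr fun _ => (eLpNorm_sub_self μ _ _).symm

/-- A strong gradient is a weak gradient. -/
theorem IsStrongGradient.isWeakGradient {f : E → ℝ} {g : E → E →L[ℝ] ℝ} {v : ℕ → E → ℝ}
    (H : IsStrongGradient μ p f g v) (hp : 1 ≤ p) : IsWeakGradient μ f g := by
  have : ProperSpace E := FiniteDimensional.proper ℝ E
  have hq : 1 ≤ ENNReal.ofReal p := by simpa using hp
  refine ⟨H.memLp_fun.locallyIntegrable hq, H.memLp_grad.locallyIntegrable hq, fun φ hφ hφc w => ?_⟩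
  have hq' := (ENNReal.HolderConjugate.conjExponent hq)
  set q' := (ENNReal.ofReal p).conjExponent
  -- By Hölder, pairing with a fixed function of the dual space is continuous in L^p; this passes
  -- integration by parts from v_k to f.
  have hconv : ∀ (ψ : E → ℝ) (_ : MemLp ψ q' μ) (F : ℕ → E → ℝ) (F₀ : E → ℝ)
      (_ : ∀ k, AEStronglyMeasurable (F k) μ) (_ : MemLp F₀ (ENNReal.ofReal p) μ)
      (_ : Tendsto (fun k => eLpNorm (F k - F₀) (ENNReal.ofReal p) μ) atTop (𝓝 0)),
      Tendsto (fun k => ∫ x, F k x * ψ x ∂μ) atTop (𝓝 (∫ x, F₀ x * ψ x ∂μ)) := by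
    intro ψ hψ F F₀ hF hF₀ hlim
    have hi : ∀ G, MemLp G (ENNReal.ofReal p) μ → Integrable (fun x => G x * ψ x) μ := fun G hG =>
      MemLp.integrable_mul hG hψ
    refine tendsto_integral_of_L1 _ (hi F₀ hF₀).1 ?_ ?_
    · filter_upwards [hlim.eventually_lt_const ENNReal.zero_lt_top] with k hk
      have : MemLp (F k) (ENNReal.ofReal p) μ := by
        have := MemLp.add (f := F k - F₀) ⟨(hF k).sub hF₀.1, hk⟩ hF₀
        simpa using this
      exact hi _ this
    · refine tendsto_of_tendsto_of_tendsto_of_le_of_le tendsto_const_nhds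
        (by simpa using ENNReal.Tendsto.mul_const hlim (.inr hψ.2.ne)) (fun _ => zero_le)
        fun k => ?_
      calc ∫⁻ x, ‖F k x * ψ x - F₀ x * ψ x‖ₑ ∂μ = eLpNorm ((F k - F₀) • ψ) 1 μ := by
            rw [eLpNorm_one_eq_lintegral_enorm]
            simp [sub_mul]
        _ ≤ _ := eLpNorm_smul_le_mul_eLpNorm hψ.1 ((hF k).sub hF₀.1)
  have hφL : MemLp φ q' μ := hφ.continuous.memLp_of_hasCompactSupport hφc
  have hφ' : Continuous fun x => fderiv ℝ φ x w :=
    (hφ.continuous_fderiv (by simp)).clm_apply continuous_const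
  have hφ'c : HasCompactSupport fun x => fderiv ℝ φ x w := hφc.fderiv_apply (𝕜 := ℝ) w
  have hφ'L : MemLp (fun x => fderiv ℝ φ x w) q' μ := hφ'.memLp_of_hasCompactSupport hφ'c
  obtain ⟨L, hL⟩ := ContDiff.lipschitzWith_of_hasCompactSupport hφc hφ (by simp)
  have h1 := hconv _ hφ'L v f H.aestronglyMeasurable_approx H.memLp_fun H.tendsto_fun
  have h2 := hconv _ hφL (fun k x => fderiv ℝ (v k) x w) (fun x => g x w)
    (fun k => (aestronglyMeasurable_fderiv μ _).apply_continuousLinearMap w)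
    (H.memLp_grad.continuousLinearMap_comp (ContinuousLinearMap.apply ℝ ℝ w)) (by
      refine tendsto_of_tendsto_of_tendsto_of_le_of_le tendsto_const_nhds ?_ (fun _ => zero_le)
        fun k => eLpNorm_apply_le μ _ (fderiv ℝ (v k) - g) w
      simpa using ENNReal.Tendsto.const_mul H.tendsto_grad (.inr enorm_ne_top))
  have h3 : ∀ k, ∫ x, v k x * fderiv ℝ φ x w ∂μ = -∫ x, fderiv ℝ (v k) x w * φ x ∂μ := by
    intro k
    obtain ⟨K, hK⟩ := H.lipschitz k
    have h := hK.integral_lineDeriv_mul_eq (μ := μ) hL hφc w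
    have h4 : ∫ x, fderiv ℝ (v k) x w * φ x ∂μ = ∫ x, lineDeriv ℝ (v k) x w * φ x ∂μ := by
      refine integral_congr_ae ?_
      filter_upwards [hK.ae_differentiableAt] with x hx
      rw [hx.lineDeriv_eq_fderiv]
    rw [h4, h, ← integral_neg]
    refine integral_congr_ae (.of_forall fun x => ?_)
    have hd : DifferentiableAt ℝ φ x := hφ.differentiable (by simp) x
    simp only [hd.lineDeriv_eq_fderiv, map_neg]
    ring
  have h5 : ∫ x, f x * fderiv ℝ φ x w ∂μ = -∫ x, g x w * φ x ∂μ :=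
    tendsto_nhds_unique h1 (by simpa only [h3] using h2.neg)
  rw [h5]
  simp only [mul_comm]

omit [μ.IsAddHaarMeasure] in
/-- Weak gradients are unique. -/
theorem IsWeakGradient.ae_eq {f : E → ℝ} {g g' : E → E →L[ℝ] ℝ} (h : IsWeakGradient μ f g)
    (h' : IsWeakGradient μ f g') : g =ᵐ[μ] g' := by
  have : ProperSpace E := FiniteDimensional.proper ℝ E
  have key : ∀ {G : E → E →L[ℝ] ℝ}, LocallyIntegrable G μ → ∀ w : E,
      LocallyIntegrable (fun x => G x w) μ := fun hG w x => by
    obtain ⟨s, hs, hs'⟩ := hG x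
    exact ⟨s, hs, hs'.apply_continuousLinearMap w⟩
  have h1 : ∀ w : E, ∀ᵐ x ∂μ, g x w = g' x w := fun w =>
    ae_eq_of_integral_contDiff_smul_eq (key h.locallyIntegrable_grad w)
      (key h'.locallyIntegrable_grad w) fun φ hφ hφc => by
        have := (h.integral_eq φ hφ hφc w).symm.trans (h'.integral_eq φ hφ hφc w)
        simpa using this
  filter_upwards [ae_all_iff.2 fun i => h1 (Module.finBasis ℝ E i)] with x hx
  exact ContinuousLinearMap.coe_injective ((Module.finBasis ℝ E).ext hx)

end Sobolev

/-! ### Weights concentrating at the origin of the half-line. -/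

section RadialLimit

/-- Weights on `(0, ∞)` which concentrate at `0` with limit mass `c` converge to `c` times the
evaluation at `0+`. -/
theorem tendsto_lintegral_mul_of_concentrating {κ : ℕ → ℝ → ℝ≥0∞} {Ψ : ℝ → ℝ≥0∞} {M c L : ℝ≥0∞}
    (hκ : ∀ n, AEMeasurable (κ n) (volume.restrict (Ioi 0))) (hM : M ≠ ⊤)
    (hΨM : ∀ r, 0 < r → Ψ r ≤ M) (hΨ : Tendsto Ψ (𝓝[>] 0) (𝓝 L)) (hc : c ≠ ⊤)
    (hnear : ∀ δ : ℝ, 0 < δ → Tendsto (fun n => ∫⁻ r in Ioc 0 δ, κ n r) atTop (𝓝 c))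
    (hfar : ∀ δ : ℝ, 0 < δ → Tendsto (fun n => ∫⁻ r in Ioi δ, κ n r) atTop (𝓝 0)) :
    Tendsto (fun n => ∫⁻ r in Ioi (0 : ℝ), κ n r * Ψ r) atTop (𝓝 (c * L)) := by
  have hL : L ≠ ⊤ := ne_top_of_le_ne_top hM
    (le_of_tendsto hΨ (by filter_upwards [self_mem_nhdsWithin] with r hr using hΨM r hr))
  have hsplit : ∀ {δ : ℝ}, 0 < δ → ∀ n, ∫⁻ r in Ioi (0 : ℝ), κ n r * Ψ r =
      (∫⁻ r in Ioc 0 δ, κ n r * Ψ r) + ∫⁻ r in Ioi δ, κ n r * Ψ r := fun hδ n => by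
    rw [← lintegral_union measurableSet_Ioi Ioc_disjoint_Ioi_same, Ioc_union_Ioi_eq_Ioi hδ.le]
  have hκ1 : ∀ {δ : ℝ} n, AEMeasurable (κ n) (volume.restrict (Ioc 0 δ)) := fun n =>
    (hκ n).mono_set Ioc_subset_Ioi_self
  refine tendsto_of_le_liminf_of_limsup_le ?_ ?_
  -- It suffices to reach c' L' for all c' < c and L' < L: near 0 one has Ψ > L', and eventually the
  -- weight there exceeds c'.
  · refine ENNReal.mul_le_of_forall_lt fun c' hc' L' hL' => le_liminf_of_le (by isBoundedDefault) ?_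
    obtain ⟨δ, hδ, hδL⟩ := mem_nhdsGT_iff_exists_Ioc_subset.1 (hΨ.eventually_const_lt hL')
    filter_upwards [(hnear δ hδ).eventually_const_lt hc'] with n hn
    calc c' * L' ≤ (∫⁻ r in Ioc 0 δ, κ n r) * L' := by gcongr
      _ = ∫⁻ r in Ioc 0 δ, κ n r * L' := (lintegral_mul_const'' _ (hκ1 n)).symm
      _ ≤ ∫⁻ r in Ioc 0 δ, κ n r * Ψ r := setLIntegral_mono' measurableSet_Ioc fun r hr => by
          gcongr; exact (hδL hr).le
      _ ≤ _ := by rw [hsplit hδ n]; exact le_self_add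
  · refine ENNReal.le_mul_of_forall_lt (.inr hL) (.inl hc) fun c' hc' L' hL' => ?_
    obtain ⟨δ, hδ, hδL⟩ := mem_nhdsGT_iff_exists_Ioc_subset.1 (hΨ.eventually_lt_const hL')
    -- Beyond δ only the bound M on Ψ is available, but the weight there tends to 0.
    have hlim : Tendsto (fun n => c' * L' + (∫⁻ r in Ioi δ, κ n r) * M) atTop (𝓝 (c' * L')) := by
      simpa using (ENNReal.Tendsto.mul_const (hfar δ hδ) (.inr hM)).const_add (c' * L')
    rw [← hlim.limsup_eq]
    refine limsup_le_limsup ?_ (by isBoundedDefault) (by isBoundedDefault)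
    filter_upwards [(hnear δ hδ).eventually_lt_const hc'] with n hn
    rw [hsplit hδ n]
    refine add_le_add ?_ ?_
    · calc ∫⁻ r in Ioc 0 δ, κ n r * Ψ r ≤ ∫⁻ r in Ioc 0 δ, κ n r * L' :=
            setLIntegral_mono' measurableSet_Ioc fun r hr => by gcongr; exact (hδL hr).le
        _ = (∫⁻ r in Ioc 0 δ, κ n r) * L' := lintegral_mul_const'' _ (hκ1 n)
        _ ≤ _ := by gcongr
    · calc ∫⁻ r in Ioi δ, κ n r * Ψ r ≤ ∫⁻ r in Ioi δ, κ n r * M :=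
            setLIntegral_mono' measurableSet_Ioi fun r hr => by
              gcongr; exact hΨM r (hδ.trans hr)
        _ = _ := lintegral_mul_const'' _ ((hκ n).mono_set (Ioi_subset_Ioi hδ.le))

/-- A radial profile is monotone only on (0, ∞) and may fail to be measurable on the rest of the
line. The replacement makes the kernel measurable and alters it at most on the diagonal. -/
theorem AntitoneOn.exists_measurable_eqOn {φ : ℝ → ℝ} {a : ℝ} (hφ : AntitoneOn φ (Ioi a)) :
    ∃ R : ℝ → ℝ, Measurable R ∧ EqOn R φ (Ioi a) := by
  have hm : Measurable fun r : Ioi a => φ r :=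
    Antitone.measurable fun r s hrs => hφ r.2 s.2 hrs
  refine ⟨Function.extend Subtype.val (fun r : Ioi a => φ r) 0,
    (MeasurableEmbedding.subtype_coe measurableSet_Ioi).measurable_extend hm measurable_zero,
    fun r hr => ?_⟩
  exact Subtype.val_injective.extend_apply (fun r : Ioi a => φ r) 0 ⟨r, hr⟩

end RadialLimit

/-! ### Mollifiers and nonlocal energies in polar coordinates. -/

section Mollifier

variable {E : Type*} [NormedAddCommGroup E] [NormedSpace ℝ E] [FiniteDimensional ℝ E]
  [Nontrivial E] [MeasurableSpace E] [BorelSpace E] {μ : Measure E} [μ.IsAddHaarMeasure]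

variable (μ) in
-- Translates the mollifier hypotheses stated on E into statements about the weight r^(N-1) ρ̃ₙ(r),
-- up to the total mass of the sphere, which is finite and nonzero.
theorem lintegral_comp_norm {κ : ℝ → ℝ} {R : ℝ → ℝ} (hR : Measurable R) (hRκ : EqOn R κ (Ioi 0))
    {A : Set ℝ} (hA : MeasurableSet A) :
    ∫⁻ y in {y : E | ‖y‖ ∈ A}, ENNReal.ofReal (κ ‖y‖) ∂μ = μ.toSphere univ *
      ∫⁻ r in A ∩ Ioi 0, ENNReal.ofReal (r ^ (Module.finrank ℝ E - 1)) * ENNReal.ofReal (κ r) := by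
  have hA' : MeasurableSet {y : E | ‖y‖ ∈ A} := hA.preimage measurable_norm
  have hm : Measurable fun y : E => ENNReal.ofReal (R ‖y‖) :=
    (hR.comp measurable_norm).ennreal_ofReal
  have h1 : ∫⁻ y in {y : E | ‖y‖ ∈ A}, ENNReal.ofReal (κ ‖y‖) ∂μ =
      ∫⁻ y in {y : E | ‖y‖ ∈ A}, ENNReal.ofReal (R ‖y‖) ∂μ := by
    refine lintegral_congr_ae (ae_restrict_of_ae ?_)
    filter_upwards [compl_mem_ae_iff.2 (measure_singleton (μ := μ) (0 : E))] with y hy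
    have hy0 : 0 < ‖y‖ := norm_pos_iff.2 hy
    rw [hRκ hy0]
  rw [h1, ← lintegral_indicator hA', lintegral_eq_lintegral_Ioi_lintegral_toSphere μ
    (hm.indicator hA'), ← lintegral_const_mul' _ _ (measure_ne_top _ _), inter_comm,
    ← Measure.restrict_restrict_of_subset (s := Ioi 0 ∩ A) inter_subset_left,
    ← lintegral_indicator (measurableSet_Ioi.inter hA)]
  refine setLIntegral_congr_fun measurableSet_Ioi fun r hr => ?_
  have hr0 : 0 < r := hr
  have hw : ∀ w : sphere (0 : E) 1, ‖r • (w : E)‖ = r := fun w => by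
    simp [norm_smul, abs_of_pos hr0]
  by_cases hrA : r ∈ A
  · rw [indicator_of_mem (show r ∈ Ioi 0 ∩ A from ⟨hr, hrA⟩), lintegral_congr fun w =>
      indicator_of_mem (by rw [mem_ofPred_eq, hw]; exact hrA) _]
    simp only [hw, hRκ hr, lintegral_const]
    ring
  · rw [indicator_of_notMem (fun h => hrA h.2), lintegral_congr fun w =>
      indicator_of_notMem (by rw [mem_ofPred_eq, hw]; exact hrA) _]
    simp

namespace IsMollifierSeq

variable {ρ : ℕ → E → E → ℝ} {ρr : ℕ → ℝ → ℝ} {C₀ : ℝ}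

omit [Nontrivial E] [FiniteDimensional ℝ E] [BorelSpace E] [μ.IsAddHaarMeasure] in
theorem aemeasurable_weight (hρ : IsMollifierSeq μ ρ ρr C₀) (n : ℕ) :
    AEMeasurable (fun r => ENNReal.ofReal (r ^ (Module.finrank ℝ E - 1)) *
      ENNReal.ofReal (ρr n r)) (volume.restrict (Ioi 0)) := by
  have := (aemeasurable_restrict_of_antitoneOn (μ := volume) measurableSet_Ioi
    (hρ.antitone n)).ennreal_ofReal
  exact AEMeasurable.mul (by fun_prop) this

theorem lintegral_weight_lt_top (hρ : IsMollifierSeq μ ρ ρr C₀) (n : ℕ) :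
    ∫⁻ r in Ioi (0 : ℝ), ENNReal.ofReal (r ^ (Module.finrank ℝ E - 1)) *
      ENNReal.ofReal (ρr n r) < ⊤ := by
  obtain ⟨c, hc⟩ := hρ.bounded
  obtain ⟨R, hR, hRρ⟩ := (hρ.antitone n).exists_measurable_eqOn
  have h := lintegral_comp_norm μ hR hRρ MeasurableSet.univ
  simp only [mem_univ, univ_inter] at h
  have h2 := hc n 0
  simp only [hρ.radial, zero_sub, norm_neg] at h2
  have h3 : μ.toSphere univ ≠ 0 := Measure.measure_univ_ne_zero.2 μ.toSphere_ne_zero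
  refine ENNReal.lt_top_of_mul_ne_top_right ?_ h3
  rw [← h]
  exact ne_top_of_le_ne_top ENNReal.coe_ne_top ((setLIntegral_le_lintegral _ _).trans h2)

theorem tendsto_near_lintegral (hρ : IsMollifierSeq μ ρ ρr C₀) {δ : ℝ} (hδ : 0 < δ) :
    Tendsto (fun n => ∫⁻ r in Ioc 0 δ, ENNReal.ofReal (r ^ (Module.finrank ℝ E - 1)) *
      ENNReal.ofReal (ρr n r)) atTop (𝓝 (ENNReal.ofReal C₀)) := by
  refine (ENNReal.tendsto_ofReal (hρ.tendsto_near δ hδ)).congr fun n => ?_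
  have heq : ∀ r ∈ Ioc 0 δ, ENNReal.ofReal (r ^ (Module.finrank ℝ E - 1) * ρr n r) =
      ENNReal.ofReal (r ^ (Module.finrank ℝ E - 1)) * ENNReal.ofReal (ρr n r) := fun r hr =>
    ENNReal.ofReal_mul (pow_nonneg hr.1.le _)
  have hnn : 0 ≤ᵐ[volume.restrict (Ioc 0 δ)]
      fun r => r ^ (Module.finrank ℝ E - 1) * ρr n r := by
    filter_upwards [ae_restrict_mem measurableSet_Ioc] with r hr
    exact mul_nonneg (pow_nonneg hr.1.le _) (hρ.nonneg n r hr.1.le)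
  have hm : AEMeasurable (ρr n) (volume.restrict (Ioc 0 δ)) :=
    (aemeasurable_restrict_of_antitoneOn measurableSet_Ioi (hρ.antitone n)).mono_set
      Ioc_subset_Ioi_self
  -- The Bochner integral of a non-integrable function is 0 by default, so integrability is proved
  -- below, from the L¹ bound on the mollifiers.
  rw [intervalIntegral.integral_of_le hδ.le, ofReal_integral_eq_lintegral_ofReal _ hnn,
    setLIntegral_congr_fun measurableSet_Ioc heq]
  refine ⟨(AEMeasurable.mul (by fun_prop) hm).aestronglyMeasurable, ?_⟩
  rw [hasFiniteIntegral_iff_ofReal hnn, setLIntegral_congr_fun measurableSet_Ioc heq]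
  exact (lintegral_mono_set Ioc_subset_Ioi_self).trans_lt (hρ.lintegral_weight_lt_top n)

theorem tendsto_far_lintegral (hρ : IsMollifierSeq μ ρ ρr C₀) {δ : ℝ} (hδ : 0 < δ) :
    Tendsto (fun n => ∫⁻ r in Ioi δ, ENNReal.ofReal (r ^ (Module.finrank ℝ E - 1)) *
      ENNReal.ofReal (ρr n r)) atTop (𝓝 0) := by
  have h0 : μ.toSphere univ ≠ 0 := Measure.measure_univ_ne_zero.2 μ.toSphere_ne_zero
  have h := ENNReal.Tendsto.const_mul (a := (μ.toSphere univ)⁻¹) (hρ.tendsto_far δ hδ 0)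
    (.inr (ENNReal.inv_ne_top.2 h0))
  rw [mul_zero] at h
  refine tendsto_of_tendsto_of_tendsto_of_le_of_le tendsto_const_nhds h (fun _ => zero_le)
    fun n => ?_
  obtain ⟨R, hR, hRρ⟩ := (hρ.antitone n).exists_measurable_eqOn
  have hball : (ball (0 : E) δ)ᶜ = {y : E | ‖y‖ ∈ Ici δ} := by ext y; simp
  have h2 := lintegral_comp_norm μ hR hRρ (measurableSet_Ici (a := δ))
  simp only [hρ.radial, zero_sub, norm_neg]
  rw [hball, h2, ← mul_assoc, ENNReal.inv_mul_cancel h0 (measure_ne_top _ _), one_mul]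
  exact lintegral_mono_set fun r hr =>
    ⟨mem_Ici.2 (mem_Ioi.1 hr).le, hδ.trans hr⟩

end IsMollifierSeq

theorem nonlocalEnergy_congr_ae {E : Type*} [NormedAddCommGroup E] [MeasurableSpace E]
    {μ : Measure E} {p : ℝ} (k : E → E → ℝ) {f f' : E → ℝ} (h : f =ᵐ[μ] f') :
    nonlocalEnergy μ p k f = nonlocalEnergy μ p k f' := by
  refine lintegral_congr_ae ?_
  filter_upwards [h] with x hx
  refine lintegral_congr_ae ?_
  filter_upwards [h] with y hy
  rw [hx, hy]

theorem enorm_rpow_eq_ofReal {p : ℝ} (hp : 0 ≤ p) (a : ℝ) :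
    ‖a‖ₑ ^ p = ENNReal.ofReal (|a| ^ p) := by
  rw [← ofReal_norm, Real.norm_eq_abs, ENNReal.ofReal_rpow_of_nonneg (abs_nonneg a) hp]

/-- The nonlocal energy with a radial kernel in polar coordinates. -/
theorem nonlocalEnergy_eq_lintegral_Ioi {p : ℝ} (hp : 1 ≤ p) {k : E → E → ℝ} {κ : ℝ → ℝ}
    (hk : ∀ x y, k x y = κ ‖x - y‖) (hκ : AntitoneOn κ (Ioi 0)) {f : E → ℝ} (hf : Measurable f) :
    nonlocalEnergy μ p k f = ∫⁻ r in Ioi (0 : ℝ),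
      ENNReal.ofReal (r ^ (Module.finrank ℝ E - 1)) * ENNReal.ofReal (κ r) *
        ∫⁻ w : sphere (0 : E) 1,
          ∫⁻ x, ‖r⁻¹ * (f (x + r • (w : E)) - f x)‖ₑ ^ p ∂μ ∂μ.toSphere := by
  have : ProperSpace E := FiniteDimensional.proper ℝ E
  have hp0 : 0 < p := one_pos.trans_le hp
  obtain ⟨R, hR, hRκ⟩ := hκ.exists_measurable_eqOn
  set F : E → E → ℝ≥0∞ := fun x z =>
    ENNReal.ofReal (|f x - f (x + z)| ^ p / ‖z‖ ^ p * R ‖z‖) with hF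
  have hFm : Measurable (Function.uncurry F) := by
    refine Measurable.ennreal_ofReal (Measurable.mul (Measurable.div ?_ ?_) ?_)
    · refine Measurable.pow_const ?_ p
      exact ((hf.comp measurable_fst).sub (hf.comp (measurable_fst.add measurable_snd))).norm
    · exact measurable_snd.norm.pow_const p
    · exact hR.comp measurable_snd.norm
  have h1 : nonlocalEnergy μ p k f = ∫⁻ x, ∫⁻ z, F x z ∂μ ∂μ := by
    refine lintegral_congr fun x => ?_
    rw [← lintegral_add_left_eq_self _ x]
    refine lintegral_congr fun z => ?_
    -- At z = 0 the profile and its replacement may differ, but the numerator 0^p vanishes.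
    rcases eq_or_ne z 0 with rfl | hz
    · simp [hF, Real.zero_rpow hp0.ne']
    · simp only [hF, hk, sub_add_cancel_left, norm_neg, hRκ (mem_Ioi.2 (norm_pos_iff.2 hz))]
  have hFm' : Measurable fun z => ∫⁻ x, F x z ∂μ := hFm.lintegral_prod_left'
  rw [h1, lintegral_lintegral_swap hFm.aemeasurable,
    lintegral_eq_lintegral_Ioi_lintegral_toSphere μ hFm']
  refine setLIntegral_congr_fun measurableSet_Ioi fun r hr => ?_
  have hr0 : 0 < r := hr
  rw [mul_assoc, ← lintegral_const_mul' (ENNReal.ofReal (κ r)) _ ENNReal.ofReal_ne_top]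
  congr 1
  refine lintegral_congr fun w => ?_
  rw [← lintegral_const_mul' _ _ ENNReal.ofReal_ne_top]
  refine lintegral_congr fun x => ?_
  have hw : ‖r • (w : E)‖ = r := by simp [norm_smul, abs_of_pos hr0]
  simp only [hF, hw, hRκ hr]
  rw [ENNReal.ofReal_mul (by positivity), mul_comm, enorm_rpow_eq_ofReal hp0.le, abs_mul,
    Real.mul_rpow (abs_nonneg _) (abs_nonneg _), abs_of_pos (inv_pos.2 hr0),
    Real.inv_rpow hr0.le, abs_sub_comm, div_eq_inv_mul]

/-- Convergence of the nonlocal energies, for a measurable function and a strong gradient. -/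
theorem IsStrongGradient.tendsto_nonlocalEnergy_of_measurable {p : ℝ} (hp : 1 ≤ p)
    {ρ : ℕ → E → E → ℝ} {ρr : ℕ → ℝ → ℝ} {C₀ : ℝ} (hρ : IsMollifierSeq μ ρ ρr C₀)
    {f : E → ℝ} (hf : Measurable f) {g : E → E →L[ℝ] ℝ} {v : ℕ → E → ℝ}
    (H : IsStrongGradient μ p f g v) :
    Tendsto (fun n => nonlocalEnergy μ p (ρ n) f) atTop (𝓝 (ENNReal.ofReal C₀ *
      ∫⁻ w : sphere (0 : E) 1, ∫⁻ x, ‖g x w‖ₑ ^ p ∂μ ∂μ.toSphere)) := by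
  have : ProperSpace E := FiniteDimensional.proper ℝ E
  have hp0 : 0 < p := one_pos.trans_le hp
  simp only [nonlocalEnergy_eq_lintegral_Ioi hp (hρ.radial _) (hρ.antitone _) hf]
  set M := eLpNorm g (ENNReal.ofReal p) μ ^ p
  have hM : M ≠ ⊤ := (ENNReal.rpow_lt_top_of_nonneg hp0.le H.memLp_grad.2.ne).ne
  -- Uniform in r and w, so M both bounds the radial factor and dominates on the sphere, whose
  -- measure is finite.
  have hbound : ∀ r : ℝ, 0 < r → ∀ w : sphere (0 : E) 1,
      ∫⁻ x, ‖r⁻¹ * (f (x + r • (w : E)) - f x)‖ₑ ^ p ∂μ ≤ M := by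
    intro r hr w
    rw [← eLpNorm_ofReal_rpow hp, eLpNorm_inv_mul_eq μ hr]
    refine ENNReal.rpow_le_rpow ?_ hp0.le
    calc _ ≤ ENNReal.ofReal r⁻¹ * (‖r • (w : E)‖ₑ * eLpNorm g (ENNReal.ofReal p) μ) := by
          gcongr
          exact (H.eLpNorm_add_sub_le hp _).trans (eLpNorm_apply_le μ _ g _)
      _ = _ := by
          have hw : ‖r • (w : E)‖ = r := by simp [norm_smul, abs_of_pos hr]
          rw [← ofReal_norm, hw, ← mul_assoc, ← ENNReal.ofReal_mul (inv_nonneg.2 hr.le),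
            inv_mul_cancel₀ hr.ne', ENNReal.ofReal_one, one_mul]
  refine tendsto_lintegral_mul_of_concentrating (M := M * μ.toSphere univ)
    hρ.aemeasurable_weight (ENNReal.mul_ne_top hM (measure_ne_top _ _)) (fun r hr => ?_) ?_
    ENNReal.ofReal_ne_top (fun δ hδ => hρ.tendsto_near_lintegral hδ)
    (fun δ hδ => hρ.tendsto_far_lintegral hδ)
  · rw [← lintegral_const]
    exact lintegral_mono (hbound r hr)
  · refine tendsto_lintegral_filter_of_dominated_convergence (fun _ => M) ?_ ?_ ?_ ?_
    · refine .of_forall fun r => Measurable.lintegral_prod_right' (f := fun q : sphere (0 : E) 1 × E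
        => ‖r⁻¹ * (f (q.2 + r • (q.1 : E)) - f q.2)‖ₑ ^ p) ?_
      refine ((Measurable.const_mul (Measurable.sub (hf.comp ?_)
        (hf.comp measurable_snd)) _).enorm).pow_const p
      fun_prop
    · filter_upwards [self_mem_nhdsWithin] with r hr
      exact .of_forall (hbound r hr)
    · rw [lintegral_const]
      exact ENNReal.mul_ne_top hM (measure_ne_top _ _)
    · refine .of_forall fun w => ?_
      have := (H.tendsto_eLpNorm hp (w : E)).ennrpow_const p
      simpa only [eLpNorm_ofReal_rpow hp] using this

omit [FiniteDimensional ℝ E] [Nontrivial E] [BorelSpace E] [μ.IsAddHaarMeasure] in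
theorem IsStrongGradient.congr {p : ℝ} {f f' : E → ℝ} {g g' : E → E →L[ℝ] ℝ} {v : ℕ → E → ℝ}
    (H : IsStrongGradient μ p f g v) (hf : f =ᵐ[μ] f') (hg : g =ᵐ[μ] g') :
    IsStrongGradient μ p f' g' v where
  memLp_fun := H.memLp_fun.ae_eq hf
  memLp_grad := H.memLp_grad.ae_eq hg
  lipschitz := H.lipschitz
  tendsto_fun := H.tendsto_fun.congr fun _ => eLpNorm_congr_ae (hf.mono fun x hx => by simp [hx])
  tendsto_grad := H.tendsto_grad.congr fun _ => eLpNorm_congr_ae (hg.mono fun x hx => by simp [hx])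

/-- Convergence of the nonlocal energies of a function with a strong gradient. -/
theorem IsStrongGradient.tendsto_nonlocalEnergy {p : ℝ} (hp : 1 ≤ p)
    {ρ : ℕ → E → E → ℝ} {ρr : ℕ → ℝ → ℝ} {C₀ : ℝ} (hρ : IsMollifierSeq μ ρ ρr C₀)
    {f : E → ℝ} {g : E → E →L[ℝ] ℝ} {v : ℕ → E → ℝ} (H : IsStrongGradient μ p f g v) :
    Tendsto (fun n => nonlocalEnergy μ p (ρ n) f) atTop (𝓝 (ENNReal.ofReal C₀ *
      ∫⁻ x, ∫⁻ w : sphere (0 : E) 1, ENNReal.ofReal (|g x w| ^ p) ∂μ.toSphere ∂μ)) := by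
  have : ProperSpace E := FiniteDimensional.proper ℝ E
  have hp0 : 0 < p := one_pos.trans_le hp
  -- Tonelli needs joint measurability. Energy and limit depend only on the almost everywhere
  -- classes of f and g, so measurable representatives may be used.
  set f' := H.memLp_fun.1.mk f
  set g' := H.memLp_grad.1.mk g
  have hf' : f =ᵐ[μ] f' := H.memLp_fun.1.ae_eq_mk
  have hg' : g =ᵐ[μ] g' := H.memLp_grad.1.ae_eq_mk
  have hgm : StronglyMeasurable g' := H.memLp_grad.1.stronglyMeasurable_mk
  have h := (H.congr hf' hg').tendsto_nonlocalEnergy_of_measurable hp hρ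
    H.memLp_fun.1.stronglyMeasurable_mk.measurable
  simp only [nonlocalEnergy_congr_ae _ hf']
  have hjoint : Measurable fun q : sphere (0 : E) 1 × E => ‖g' q.2 q.1‖ₑ ^ p := by
    have hs : StronglyMeasurable fun q : sphere (0 : E) 1 × E => g' q.2 (q.1 : E) :=
      isBoundedBilinearMap_apply.continuous.comp_stronglyMeasurable
        ((hgm.comp_measurable measurable_snd).prodMk
          (measurable_subtype_coe.comp measurable_fst).stronglyMeasurable)
    exact hs.measurable.enorm.pow_const p
  have heq : ∫⁻ x, ∫⁻ w : sphere (0 : E) 1, ENNReal.ofReal (|g x w| ^ p) ∂μ.toSphere ∂μ =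
      ∫⁻ w : sphere (0 : E) 1, ∫⁻ x, ‖g' x w‖ₑ ^ p ∂μ ∂μ.toSphere := by
    rw [lintegral_lintegral_swap (f := fun (w : sphere (0 : E) 1) x => ‖g' x w‖ₑ ^ p)
      hjoint.aemeasurable]
    refine lintegral_congr_ae ?_
    filter_upwards [hg'] with x hx
    simp only [hx, enorm_rpow_eq_ofReal hp0.le]
  rwa [heq]

end Mollifier

/-- Here `μ` is a Lebesgue measure on the finite-dimensional normed space `E`, and `μ.toSphere` is
the boundary measure of the unit ball: it agrees with the Minkowski content on every closed subset
of the unit sphere (first conjunct), which determines it. -/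
theorem proposition4 {E : Type*} [NormedAddCommGroup E] [NormedSpace ℝ E] [FiniteDimensional ℝ E]
    [Nontrivial E] [MeasurableSpace E] [BorelSpace E] (μ : Measure E) [μ.IsAddHaarMeasure]
    (p : ℝ) (hp : 1 ≤ p)
    (ρ : ℕ → E → E → ℝ) (ρr : ℕ → ℝ → ℝ) (C₀ : ℝ) (hρ : IsMollifierSeq μ ρ ρr C₀)
    (f : E → ℝ)
    (hf : (1 < p ∧ MemMetricSobolev μ p f) ∨
      ((∃ K : ℝ≥0, LipschitzWith K f) ∧ HasCompactSupport f)) :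
    (∀ K : Set (sphere (0 : E) 1), IsClosed K →
        μ.toSphere K = unitSphereContent μ ((fun v : sphere (0 : E) 1 => (v : E)) '' K)) ∧
      (∃ g : E → E →L[ℝ] ℝ, IsWeakGradient μ f g ∧ MemLp g (ENNReal.ofReal p) μ) ∧
      ∀ g : E → E →L[ℝ] ℝ, IsWeakGradient μ f g →
        Tendsto (fun n => nonlocalEnergy μ p (ρ n) f) atTop
          (𝓝 (ENNReal.ofReal C₀ *
            ∫⁻ x, ∫⁻ v : sphere (0 : E) 1, ENNReal.ofReal (|g x v| ^ p) ∂μ.toSphere ∂μ)) := by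
  obtain ⟨g₀, v, H⟩ : ∃ g v, IsStrongGradient μ p f g v := by
    rcases hf with ⟨hp1, hf⟩ | ⟨⟨K, hK⟩, hfc⟩
    · exact hf.exists_isStrongGradient hp1
    · exact ⟨_, _, hK.isStrongGradient hfc p⟩
  have hg₀ := H.isWeakGradient hp
  -- By uniqueness an arbitrary weak gradient agrees almost everywhere with g₀, hence is itself
  -- strong.
  exact ⟨fun K hK => toSphere_eq_unitSphereContent μ hK, ⟨g₀, hg₀, H.memLp_grad⟩,
    fun g hg => (H.congr ae_eq_rfl (hg₀.ae_eq hg)).tendsto_nonlocalEnergy hp hρ⟩
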